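/- Let $\widetilde{M}_2(5)$ be the affine variety over $\mathbb{Q}$ parametrising the tuples $(f,p_1,\dots,p_5)$, where $f:\mathbb{P}^1\to\mathbb{P}^1$ is an endomorphism of degree $2$ and $p_1,\dots,p_5\in\mathbb{P}^1$ are pairwise distinct points such that $f(p_i)=p_{i+1}$ for $1\le i\le 4$ and $f(p_5)=p_1$; it is a locally closed subvariety of $\mathbb{P}^5\times(\mathbb{P}^1)^5$, where the endomorphism $[u:v]\mapsto[a_0u^2+a_1uv+a_2v^2:a_3u^2+a_4uv+a_5v^2]$ corresponds to $(a_0:\dots:a_5)\in\mathbb{P}^5$. The group $\mathrm{PGL}_2$ acts on it by $g\cdot(f,p_1,\dots,p_5)=(gfg^{-1},g(p_1),\dots,g(p_5))$. Let $M_2(5)=\widetilde{M}_2(5)/\mathrm{PGL}_2$ be the quotient, an affine surface over $\mathbb{Q}$ whose coordinate ring is the ring of $\mathrm{PGL}_2$-invariant regular functions on $\widetilde{M}_2(5)$, and let $\sigma_5$ be the automorphism of $M_2(5)$ that sends the class of $(f,p_1,p_2,p_3,p_4,p_5)$ to the class of $(f,p_2,p_3,p_4,p_5,p_1)$. Then the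 quotient surface $M_2(5)/\langle\sigma_5\rangle$ is rational over $\mathbb{Q}$, that is, birational over $\mathbb{Q}$ to the affine plane $\mathbb{A}^2_{\mathbb{Q}}$. -/

import Mathlib

open scoped LinearAlgebra.Projectivization MatrixGroups

noncomputable section

namespace PeriodFive

/-!
Varieties over `ℚ` are described classically: a (reduced) variety is given by its points over the
algebraic closure `K` of `ℚ`, and its regular functions are the `K`-valued functions on these
points that are Zariski-locally quotients of polynomials with coefficients in `ℚ`.
-/

/-- The algebraic closure of `ℚ`. -/
abbrev K : Type := AlgebraicClosure ℚ

/-- The points of the projective line. -/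
abbrev P1 : Type := ℙ K (Fin 2 → K)

/-- The pair of binary quadratic forms
`(a₀ u² + a₁ u v + a₂ v², a₃ u² + a₄ u v + a₅ v²)`, evaluated at `w = (u, v)`. -/
def quad (a : Fin 6 → K) (w : Fin 2 → K) : Fin 2 → K :=
  ![a 0 * w 0 ^ 2 + a 1 * w 0 * w 1 + a 2 * w 1 ^ 2,
    a 3 * w 0 ^ 2 + a 4 * w 0 * w 1 + a 5 * w 1 ^ 2]

/-- The points of the variety of endomorphisms of degree `2` of the projective line: the points
`(a₀ : ⋯ : a₅)` of `ℙ⁵` for which the two quadratic forms have no common root. -/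
def End2 : Type :=
  {a : ℙ K (Fin 6 → K) // ∀ w : Fin 2 → K, w ≠ 0 → quad a.rep w ≠ 0}

/-- The map on points of an endomorphism of degree `2`. As `quad` is homogeneous in both arguments,
the value does not depend on the chosen representatives. -/
def End2.eval (f : End2) (q : P1) : P1 :=
  Projectivization.mk K (quad f.1.rep q.rep) (f.2 _ q.rep_nonzero)

/-- The points of `M̃₂(5)`: tuples `(f, p₁, …, p₅)` where `f` is an endomorphism of degree `2` of the
projective line and `p₁, …, p₅` are distinct points with `f(pᵢ) = pᵢ₊₁` and `f(p₅) = p₁`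
(the indices lie in `Fin 5`, where addition is cyclic). -/
@[ext]
structure MTilde : Type where
  /-- the endomorphism -/
  f : End2
  /-- the five points of the cycle -/
  p : Fin 5 → P1
  inj : Function.Injective p
  cycle : ∀ i, f.eval (p i) = p (i + 1)

/-- The points `x` and `y` of `M̃₂(5)` lie in the same orbit of `PGL₂`, which acts by
`g · (f, p₁, …, p₅) = (g ∘ f ∘ g⁻¹, g(p₁), …, g(p₅))`. -/
def SameOrbit (x y : MTilde) : Prop :=
  ∃ g : PGL(Fin 2, K), (∀ q, y.f.eval (g • q) = g • x.f.eval q) ∧ ∀ i, y.p i = g • x.p i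

/-- The cyclic shift `(f, p₁, p₂, …, p₅) ↦ (f, p₂, …, p₅, p₁)`. -/
def shift (x : MTilde) : MTilde where
  f := x.f
  p i := x.p (i + 1)
  inj := x.inj.comp (add_left_injective 1)
  cycle i := x.cycle (i + 1)

/-- The index set of the homogeneous coordinates on `ℙ⁵ × (ℙ¹)⁵`. -/
abbrev Coord : Type := Fin 6 ⊕ (Fin 5 × Fin 2)

/-- The multidegrees of the homogeneous coordinates on `ℙ⁵ × (ℙ¹)⁵`. -/
def multideg : Coord → ℕ × (Fin 5 → ℕ)
  | .inl _ => (1, 0)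
  | .inr (i, _) => (0, Pi.single i 1)

/-- Homogeneous coordinates of a point of `M̃₂(5) ⊆ ℙ⁵ × (ℙ¹)⁵`. -/
def MTilde.coord (x : MTilde) : Coord → K
  | .inl j => x.f.1.rep j
  | .inr (i, k) => (x.p i).rep k

/-- The function `h` on `M̃₂(5)` is regular over `ℚ` at `x`: on a Zariski open neighbourhood of `x`
it is the quotient of two multihomogeneous polynomials over `ℚ` of the same multidegree. -/
def IsRegularAt (h : MTilde → K) (x : MTilde) : Prop :=
  ∃ (m : ℕ × (Fin 5 → ℕ)) (P Q : MvPolynomial Coord ℚ),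
    P.IsWeightedHomogeneous multideg m ∧ Q.IsWeightedHomogeneous multideg m ∧
    MvPolynomial.aeval x.coord Q ≠ 0 ∧
    ∀ y : MTilde, MvPolynomial.aeval y.coord Q ≠ 0 →
      h y = MvPolynomial.aeval y.coord P / MvPolynomial.aeval y.coord Q

/-- The coordinate ring of the affine `ℚ`-variety `M̃₂(5)`: the functions that are regular over `ℚ`
at every point. -/
def coordRingMTilde : Subalgebra ℚ (MTilde → K) where
  carrier := {h | ∀ x, IsRegularAt h x}
  mul_mem' := by
    intro h₁ h₂ H₁ H₂ x
    obtain ⟨m₁, P₁, Q₁, hP₁, hQ₁, hx₁, e₁⟩ := H₁ x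
    obtain ⟨m₂, P₂, Q₂, hP₂, hQ₂, hx₂, e₂⟩ := H₂ x
    refine ⟨m₁ + m₂, P₁ * P₂, Q₁ * Q₂, hP₁.mul hP₂, hQ₁.mul hQ₂, ?_, ?_⟩
    · rw [map_mul]; exact mul_ne_zero hx₁ hx₂
    · intro y hy
      rw [map_mul] at hy
      rw [Pi.mul_apply, e₁ y (left_ne_zero_of_mul hy), e₂ y (right_ne_zero_of_mul hy), map_mul,
        map_mul, div_mul_div_comm]
  add_mem' := by
    intro h₁ h₂ H₁ H₂ x
    obtain ⟨m₁, P₁, Q₁, hP₁, hQ₁, hx₁, e₁⟩ := H₁ x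
    obtain ⟨m₂, P₂, Q₂, hP₂, hQ₂, hx₂, e₂⟩ := H₂ x
    refine ⟨m₁ + m₂, P₁ * Q₂ + Q₁ * P₂, Q₁ * Q₂, (hP₁.mul hQ₂).add (hQ₁.mul hP₂), hQ₁.mul hQ₂,
      ?_, ?_⟩
    · rw [map_mul]; exact mul_ne_zero hx₁ hx₂
    · intro y hy
      rw [map_mul] at hy
      rw [Pi.add_apply, e₁ y (left_ne_zero_of_mul hy), e₂ y (right_ne_zero_of_mul hy),
        div_add_div _ _ (left_ne_zero_of_mul hy) (right_ne_zero_of_mul hy)]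
      simp only [map_mul, map_add]
  algebraMap_mem' := by
    intro r x
    refine ⟨0, MvPolynomial.C r, 1, MvPolynomial.isWeightedHomogeneous_C _ _,
      MvPolynomial.isWeightedHomogeneous_one _ _, ?_, ?_⟩
    · rw [map_one]; exact one_ne_zero
    · intro y _
      rw [map_one, div_one, MvPolynomial.algHom_C]
      rfl

/-- The coordinate ring of the affine variety `M₂(5) = M̃₂(5) / PGL₂`: the regular functions on
`M̃₂(5)` that are constant on the orbits of `PGL₂`. (The regular functions on a geometric quotient
are the invariant regular functions upstairs.) -/
def coordRingM : Subalgebra ℚ (MTilde → K) where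
  carrier := {h | h ∈ coordRingMTilde ∧ ∀ x y, SameOrbit x y → h x = h y}
  mul_mem' := fun H₁ H₂ ↦ ⟨mul_mem H₁.1 H₂.1, fun x y r ↦
    congrArg₂ (· * ·) (H₁.2 x y r) (H₂.2 x y r)⟩
  add_mem' := fun H₁ H₂ ↦ ⟨add_mem H₁.1 H₂.1, fun x y r ↦
    congrArg₂ (· + ·) (H₁.2 x y r) (H₂.2 x y r)⟩
  algebraMap_mem' := fun r ↦ ⟨algebraMap_mem _ r, fun _ _ _ ↦ rfl⟩

/-- The effect of the shift on the homogeneous coordinates. -/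
def shiftCoord : Coord → Coord
  | .inl j => .inl j
  | .inr (i, k) => .inr (i + 1, k)

theorem coord_shift (x : MTilde) : (shift x).coord = x.coord ∘ shiftCoord := by
  funext c
  rcases c with j | ⟨i, k⟩ <;> rfl

/-- The effect of the shift on multidegrees. -/
def shiftDeg : (ℕ × (Fin 5 → ℕ)) →+ (ℕ × (Fin 5 → ℕ)) where
  toFun m := (m.1, fun i ↦ m.2 (i - 1))
  map_zero' := rfl
  map_add' _ _ := rfl

theorem multideg_shiftCoord (c : Coord) : multideg (shiftCoord c) = shiftDeg (multideg c) := by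
  rcases c with j | ⟨i, k⟩
  · rfl
  · refine Prod.ext rfl (funext fun l ↦ ?_)
    simp [multideg, shiftCoord, shiftDeg, Pi.single_apply, sub_eq_iff_eq_add]

theorem isWeightedHomogeneous_shift {P : MvPolynomial Coord ℚ} {m : ℕ × (Fin 5 → ℕ)}
    (hP : P.IsWeightedHomogeneous multideg m) :
    (MvPolynomial.rename shiftCoord P).IsWeightedHomogeneous multideg (shiftDeg m) := by
  classical
  intro d hd
  obtain ⟨u, rfl, hu⟩ := MvPolynomial.coeff_rename_ne_zero _ _ _ hd
  rw [← hP hu, Finsupp.weight_apply, Finsupp.weight_apply,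
    Finsupp.sum_mapDomain_index (by simp) (by intros; rw [add_smul]), map_finsuppSum]
  simp only [multideg_shiftCoord, map_nsmul]

theorem comp_shift_mem {h : MTilde → K} (H : h ∈ coordRingM) : h ∘ shift ∈ coordRingM := by
  refine ⟨fun x ↦ ?_, fun x y r ↦ ?_⟩
  · obtain ⟨m, P, Q, hP, hQ, hx, e⟩ := H.1 (shift x)
    refine ⟨shiftDeg m, MvPolynomial.rename shiftCoord P, MvPolynomial.rename shiftCoord Q,
      isWeightedHomogeneous_shift hP, isWeightedHomogeneous_shift hQ, ?_, fun y hy ↦ ?_⟩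
    · rwa [MvPolynomial.aeval_rename, ← coord_shift]
    · rw [MvPolynomial.aeval_rename, ← coord_shift] at hy ⊢
      rw [MvPolynomial.aeval_rename, ← coord_shift]
      exact e _ hy
  · obtain ⟨g, hf, hp⟩ := r
    exact H.2 _ _ ⟨g, hf, fun i ↦ hp (i + 1)⟩

/-- The comorphism `h ↦ h ∘ σ₅` of the automorphism `σ₅` of `M₂(5)` that sends the class of
`(f, p₁, p₂, …, p₅)` to the class of `(f, p₂, …, p₅, p₁)`. -/
def sigmaStar : coordRingM →ₐ[ℚ] coordRingM where
  toFun h := ⟨h.1 ∘ shift, comp_shift_mem h.2⟩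
  map_one' := rfl
  map_mul' _ _ := rfl
  map_zero' := rfl
  map_add' _ _ := rfl
  commutes' _ := rfl

/-- The coordinate ring of the quotient of the affine variety `M₂(5)` by the finite cyclic group
generated by `σ₅`: the functions on `M₂(5)` that are fixed by `σ₅`. -/
def coordRingQuotient : Subalgebra ℚ coordRingM :=
  AlgHom.equalizer sigmaStar (AlgHom.id ℚ coordRingM)

open AlgebraicGeometry CategoryTheory

/-- The quotient surface `M₂(5) / ⟨σ₅⟩` of the affine variety `M₂(5) = Spec coordRingM`, as a scheme:
the spectrum of the ring of `σ₅`-invariant functions. -/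
def MQuotient : Scheme.{0} := Spec (CommRingCat.of coordRingQuotient)

/-- The structure morphism of `M₂(5) / ⟨σ₅⟩` over `ℚ`. -/
def MQuotient.toSpecRat : MQuotient ⟶ Spec (CommRingCat.of ℚ) :=
  Spec.map (CommRingCat.ofHom (algebraMap ℚ coordRingQuotient))

end PeriodFive

end

open scoped LinearAlgebra.Projectivization MatrixGroups

noncomputable section

namespace PeriodFive

/-! ### Lyness cycles -/

/-! A quadratic map has five parameters and a 5-cycle imposes five linear conditions on its
coefficients, so the map is determined by the cycle, and `M₂(5)` is an open part of the moduli space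
of five ordered points on the line. Cross-ratios `W i` of four consecutive points are coordinates
there: they form a Lyness cycle, hence are rational functions of `z = W 0` and `w = W 1`, and `σ₅`
rotates them. Every orbit contains the normalized point with these parameters
(`exists_sameOrbit_slice`). By the Nullstellensatz an invariant regular function is a polynomial in
`z`, `w` divided by a power of `sliceB z w` (`exists_sliceB_pow_mul_eq`). Up to a monomial in the `W
i`, `sliceB` is `y = cycY W`; the `W i` are themselves units, with product `s + 3`, where `s = cycS
W`.

The rotation invariants in `ℚ[W]` are generated by `s`, `p = cycP W`, `q = cycQ W`
(`IsLyness.mem_of_invariant`), and `q` can be traded for `y`. The quotient is thus an open part of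
the double plane `y² = F(s, p)` of `IsLyness.cycY_sq`, where `F` is cubic in `p`.

Put `u = numU s p / y` and `v = numV s p / y`. Modulo `y² = F` a polynomial identity gives `s = numS
u v / denS u v` (`denS_mul`). Since `s * numU - 5 * numV = (s² - 5s - 25)²`, one recovers `y` from
`s`, `u`, `v`, and then `p`, which is linear in `numU`. So the invariant ring and `ℚ[u, v]` agree
after inverting `denom u v` (`coordRingQuotient_le_parAlgebra`). Finally `u`, `v` are algebraically
independent, since all of `M₂(5)`, of dimension two, is algebraic over them (`parHom_injective`). -/

section Lyness

variable {R : Type*} [CommRing R]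

/-- A five-cycle of the Lyness recurrence, numbered so that `W (i + 2)` and `W (i + 3)` are the two
neighbours of `W i`. -/
def IsLyness (W : Fin 5 → R) : Prop := ∀ i, W (i + 2) * W (i + 3) = 1 + W i

/-- The sum of the members of a cycle. -/
def cycS (W : Fin 5 → R) : R := ∑ i, W i

/-- The sum of the products of neighbouring members of a cycle. -/
def cycP (W : Fin 5 → R) : R := ∑ i, W i * W (i + 2)

/-- The sum of the products of the square of a member of a cycle with its successor. -/
def cycQ (W : Fin 5 → R) : R := ∑ i, W i ^ 2 * W (i + 2)

/-- The product of the differences of neighbouring members of a cycle. -/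
def cycY (W : Fin 5 → R) : R := ∏ i, (W i - W (i + 2))

variable {W : Fin 5 → R}

/-- Writing the sum in neighbour order from `i` lets the identities below be checked for a general
`i` without cases. -/
theorem sum_shift_two (F : Fin 5 → R) (i : Fin 5) :
    ∑ j, F j = F i + F (i + 2) + F (i + 4) + F (i + 1) + F (i + 3) := by
  rw [← Equiv.sum_comp (Equiv.addLeft i) F]
  simp only [Fin.sum_univ_five, Equiv.coe_addLeft, add_zero]
  ring

theorem IsLyness.relations (h : IsLyness W) (i : Fin 5) :
    W i * W (i + 4) = 1 + W (i + 2) ∧ W (i + 2) * W (i + 1) = 1 + W (i + 4) ∧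
    W (i + 4) * W (i + 3) = 1 + W (i + 1) ∧ W (i + 1) * W i = 1 + W (i + 3) ∧
    W (i + 3) * W (i + 2) = 1 + W i := by
  have h0 := h i
  have h1 := h (i + 1)
  have h2 := h (i + 2)
  have h3 := h (i + 3)
  have h4 := h (i + 4)
  simp only [add_assoc, Fin.reduceAdd, add_zero] at h1 h2 h3 h4
  refine ⟨?_, ?_, ?_, ?_, ?_⟩
  · rw [mul_comm]; exact h2
  · rw [mul_comm]; exact h4
  · rw [mul_comm]; exact h1
  · rw [mul_comm]; exact h3
  · rw [mul_comm]; exact h0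

variable [Algebra ℚ R]

/-- The module spanned over `S` by `1`, the members of the cycle and the products of neighbours. -/
def cycModule (S : Subalgebra ℚ R) (W : Fin 5 → R) : Submodule S R :=
  Submodule.span S ({1} ∪ Set.range W ∪ Set.range fun i ↦ W i * W (i + 2))

variable {S : Subalgebra ℚ R}

theorem mul_mem_cycModule {c m : R} (hc : c ∈ S) (hm : m ∈ cycModule S W) :
    c * m ∈ cycModule S W :=
  (cycModule S W).smul_mem (⟨c, hc⟩ : S) hm

theorem one_mem_cycModule : (1 : R) ∈ cycModule S W :=
  Submodule.subset_span (Or.inl (Or.inl rfl))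

theorem mem_cycModule (i : Fin 5) : W i ∈ cycModule S W :=
  Submodule.subset_span (Or.inl (Or.inr ⟨i, rfl⟩))

theorem mul_mem_cycModule_of_neighbour {i j : Fin 5} (h : j = i + 2) :
    W i * W j ∈ cycModule S W :=
  Submodule.subset_span (Or.inr ⟨i, by rw [h]⟩)

theorem mem_cycModule_of_mem {c : R} (hc : c ∈ S) : c ∈ cycModule S W := by
  simpa using mul_mem_cycModule hc (one_mem_cycModule (W := W))

theorem natCast_mul_mem_cycModule (n : ℕ) {m : R} (hm : m ∈ cycModule S W) :
    (n : R) * m ∈ cycModule S W :=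
  mul_mem_cycModule (natCast_mem S n) hm

/-- Expand `cycS W * W i`: products with the two neighbours are generators, and those with the two
other members are affine linear by the recurrence. -/
theorem IsLyness.sq_mem (h : IsLyness W) (hs : cycS W ∈ S) (i : Fin 5) :
    W i ^ 2 ∈ cycModule S W := by
  obtain ⟨r1, r2, r3, r4, r5⟩ := h.relations i
  have e : W i ^ 2 = cycS W * W i - 1 - 1 - W (i + 2) - W (i + 3) - W i * W (i + 2) -
      W (i + 3) * W i := by
    rw [cycS, sum_shift_two W i]
    linear_combination -r1 - r4
  rw [e]
  have m2 : W (i + 3) * W i ∈ cycModule S W :=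
    mul_mem_cycModule_of_neighbour (by rw [add_assoc]; simp)
  exact sub_mem (sub_mem (sub_mem (sub_mem (sub_mem (sub_mem
    (mul_mem_cycModule hs (mem_cycModule i)) one_mem_cycModule) one_mem_cycModule)
    (mem_cycModule _)) (mem_cycModule _)) (mul_mem_cycModule_of_neighbour rfl)) m2

/-- In `cycP W * W i - cycS W * (W (i + 3) * W i)` the terms `W (i + 3) * W i ^ 2` cancel. Modulo
elements already known to lie in the module, the difference of two consecutive terms of `cycQ W`
remains. -/
theorem IsLyness.sq_mul_sub_mem (h : IsLyness W) (hs : cycS W ∈ S) (hp : cycP W ∈ S)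
    (i : Fin 5) :
    W i ^ 2 * W (i + 2) - W (i + 3) ^ 2 * W i ∈ cycModule S W := by
  obtain ⟨r1, r2, r3, r4, r5⟩ := h.relations i
  have e : W i ^ 2 * W (i + 2) - W (i + 3) ^ 2 * W i = cycP W * W i -
      cycS W * (W (i + 3) * W i) + W i + W i + W i ^ 2 + W (i + 3) - W (i + 2) - W (i + 4) -
      W (i + 1) - W (i + 2) ^ 2 := by
    rw [cycP, cycS, sum_shift_two W i, sum_shift_two (fun i ↦ W i * W (i + 2)) i]
    simp only [add_assoc, Fin.reduceAdd, add_zero]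
    linear_combination (-W (i + 2) - W (i + 1) + W (i + 3)) * r1 - r2 + (1 + W i) * r5
  rw [e]
  have m2 : W (i + 3) * W i ∈ cycModule S W :=
    mul_mem_cycModule_of_neighbour (by rw [add_assoc]; simp)
  exact sub_mem (sub_mem (sub_mem (sub_mem (add_mem (add_mem (add_mem (add_mem (sub_mem
    (mul_mem_cycModule hp (mem_cycModule i)) (mul_mem_cycModule hs m2)) (mem_cycModule _))
    (mem_cycModule _)) (h.sq_mem hs _)) (mem_cycModule _)) (mem_cycModule _)) (mem_cycModule _))
    (mem_cycModule _)) (h.sq_mem hs _)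

theorem IsLyness.sq_mul_mem (h : IsLyness W) (hs : cycS W ∈ S) (hp : cycP W ∈ S)
    (hq : cycQ W ∈ S) (i : Fin 5) : W i ^ 2 * W (i + 2) ∈ cycModule S W := by
  have d (j : Fin 5) := h.sq_mul_sub_mem hs hp j
  have d1 := d (i + 2)
  have d2 := d (i + 4)
  have d3 := d (i + 1)
  have d4 := d (i + 3)
  simp only [add_assoc, Fin.reduceAdd, add_zero] at d1 d2 d3 d4
  -- The consecutive differences of the five terms of `cycQ W` are known; the weights 4, 3, 2, 1
  -- turn their sum into five copies of a single term.
  have e : W i ^ 2 * W (i + 2) = algebraMap ℚ R (1 / 5) * (cycQ W -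
      (4 : ℕ) * (W (i + 2) ^ 2 * W (i + 4) - W i ^ 2 * W (i + 2)) -
      (3 : ℕ) * (W (i + 4) ^ 2 * W (i + 1) - W (i + 2) ^ 2 * W (i + 4)) -
      (2 : ℕ) * (W (i + 1) ^ 2 * W (i + 3) - W (i + 4) ^ 2 * W (i + 1)) -
      (W (i + 3) ^ 2 * W i - W (i + 1) ^ 2 * W (i + 3))) := by
    have h5 : algebraMap ℚ R (1 / 5) * 5 = 1 := by
      rw [← map_ofNat (algebraMap ℚ R) 5, ← map_mul]; norm_num
    rw [cycQ, sum_shift_two (fun i ↦ W i ^ 2 * W (i + 2)) i]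
    simp only [add_assoc, Fin.reduceAdd, add_zero]
    push_cast
    linear_combination -(W i ^ 2 * W (i + 2)) * h5
  rw [e]
  exact mul_mem_cycModule (S.algebraMap_mem _) (sub_mem (sub_mem (sub_mem (sub_mem
    (mem_cycModule_of_mem hq) (natCast_mul_mem_cycModule _ d1)) (natCast_mul_mem_cycModule _ d2))
    (natCast_mul_mem_cycModule _ d3)) d4)

/-- The module `cycModule S W` is closed under multiplication by the members of the cycle. -/
theorem IsLyness.mul_mem (h : IsLyness W) (hs : cycS W ∈ S) (hp : cycP W ∈ S)
    (hq : cycQ W ∈ S) (i : Fin 5) {m : R} (hm : m ∈ cycModule S W) :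
    W i * m ∈ cycModule S W := by
  obtain ⟨r1, r2, r3, r4, r5⟩ := h.relations i
  have key (j : Fin 5) : W i * W j ∈ cycModule S W ∧
      W i * (W j * W (j + 2)) ∈ cycModule S W := by
    obtain ⟨k, rfl⟩ : ∃ k, j = i + k := ⟨j - i, by abel⟩
    have m1 := one_mem_cycModule (S := S) (W := W)
    have mW (j : Fin 5) := mem_cycModule (S := S) (W := W) j
    have msq (j : Fin 5) := h.sq_mem hs j
    have mcu := h.sq_mul_mem hs hp hq
    have m3 : W (i + 3) * W i ∈ cycModule S W :=
      mul_mem_cycModule_of_neighbour (by rw [add_assoc]; simp)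
    fin_cases k
    · refine ⟨by simpa [sq] using msq i, ?_⟩
      simpa [sq, mul_assoc] using mcu i
    · refine ⟨?_, ?_⟩
      · have : W i * W (i + 1) = 1 + W (i + 3) := by linear_combination r4
        exact this ▸ add_mem m1 (mW _)
      · have : W i * (W (i + 1) * W (i + 3)) = W (i + 3) + W (i + 3) ^ 2 := by
          linear_combination W (i + 3) * r4
        simpa only [add_assoc, Fin.reduceAdd, Fin.mk_one, this] using! add_mem (mW _) (msq _)
    · refine ⟨mul_mem_cycModule_of_neighbour rfl, ?_⟩
      have : W i * (W (i + 2) * W (i + 4)) = W (i + 2) + W (i + 2) ^ 2 := by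
        linear_combination W (i + 2) * r1
      simpa only [add_assoc, Fin.reduceAdd, Fin.reduceFinMk, this] using! add_mem (mW _) (msq _)
    · refine ⟨by simpa only [mul_comm] using! m3, ?_⟩
      -- Here the square falls on the later of two neighbours, so this is not a term of `cycQ W`.
      -- Multiplying the pair by `cycS W` exchanges it for `W (i + 3) ^ 2 * W i`, which is one.
      have : W i * (W (i + 3) * W i) = cycS W * (W (i + 3) * W i) - W (i + 3) ^ 2 * W i - W i -
          W i - 1 - W i ^ 2 - W (i + 3) - W (i + 3) - W (i + 3) ^ 2 := by
        rw [cycS, sum_shift_two W i]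
        linear_combination -W (i + 3) * r4 - W i * r5 - W (i + 3) * r1 - r5
      have h5 := mcu (i + 3)
      simp only [add_assoc, Fin.reduceAdd, add_zero, Fin.reduceFinMk] at h5 ⊢
      rw [this]
      exact sub_mem (sub_mem (sub_mem (sub_mem (sub_mem (sub_mem (sub_mem (sub_mem
        (mul_mem_cycModule hs m3) h5) (mW _)) (mW _)) m1) (msq _)) (mW _)) (mW _)) (msq _)
    · refine ⟨?_, ?_⟩
      · exact r1 ▸ add_mem m1 (mW _)
      · have : W i * (W (i + 4) * W (i + 1)) = W (i + 1) + (1 + W (i + 4)) := by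
          linear_combination W (i + 1) * r1 + r2
        simpa only [add_assoc, Fin.reduceAdd, Fin.reduceFinMk, this] using!
          add_mem (mW _) (add_mem m1 (mW _))
  induction hm using Submodule.span_induction with
  | mem x hx =>
    rcases hx with (rfl | ⟨j, rfl⟩) | ⟨j, rfl⟩
    · simpa using mem_cycModule i
    · exact (key j).1
    · exact (key j).2
  | zero => simp
  | add x y _ _ hx hy => rw [mul_add]; exact add_mem hx hy
  | smul c x _ hx => rw [mul_smul_comm]; exact Submodule.smul_mem _ _ hx

theorem IsLyness.adjoin_le (h : IsLyness W) (hs : cycS W ∈ S) (hp : cycP W ∈ S)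
    (hq : cycQ W ∈ S) {r : R} (hr : r ∈ Algebra.adjoin ℚ (Set.range W)) :
    r ∈ cycModule S W := by
  have key : ∀ m ∈ cycModule S W, r * m ∈ cycModule S W := by
    induction hr using Algebra.adjoin_induction with
    | mem x hx =>
      obtain ⟨i, rfl⟩ := hx
      exact fun m hm ↦ h.mul_mem hs hp hq i hm
    | algebraMap c => exact fun m hm ↦ mul_mem_cycModule (S.algebraMap_mem c) hm
    | add x y _ _ hx hy => exact fun m hm ↦ by rw [add_mul]; exact add_mem (hx m hm) (hy m hm)
    | mul x y _ _ hx hy => exact fun m hm ↦ by rw [mul_assoc]; exact hx _ (hy m hm)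
  simpa using key 1 one_mem_cycModule

/-- The trace of an element of `cycModule S W` under a cyclic shift lies in `S`. -/
theorem trace_mem_of_mem_cycModule (hs : cycS W ∈ S) (hp : cycP W ∈ S) {τ : R →ₐ[ℚ] R}
    (hτ : ∀ i, τ (W i) = W (i + 1)) (hS : ∀ c ∈ S, τ c = c) {m : R}
    (hm : m ∈ cycModule S W) :
    m + τ m + τ (τ m) + τ (τ (τ m)) + τ (τ (τ (τ m))) ∈ S := by
  induction hm using Submodule.span_induction with
  | mem x hx =>
    rcases hx with (rfl | ⟨j, rfl⟩) | ⟨j, rfl⟩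
    · simp only [map_one]
      exact add_mem (add_mem (add_mem (add_mem S.one_mem S.one_mem) S.one_mem) S.one_mem) S.one_mem
    · simp only [hτ, add_assoc, Fin.reduceAdd]
      rw [cycS, sum_shift_two W j] at hs
      convert hs using 1
      ring
    · simp only [map_mul, hτ, add_assoc, Fin.reduceAdd, add_zero]
      rw [cycP, sum_shift_two (fun i ↦ W i * W (i + 2)) j] at hp
      simp only [add_assoc, Fin.reduceAdd, add_zero] at hp
      convert hp using 1
      ring
  | zero => simp
  | add x y _ _ hx hy =>
    convert add_mem hx hy using 1
    simp only [map_add]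
    ring
  | smul c x _ hx =>
    convert mul_mem c.2 hx using 1
    simp only [Subalgebra.smul_def, smul_eq_mul, map_mul, hS _ c.2]
    ring

/-- A shift-invariant polynomial in the members of a Lyness cycle is a polynomial in `cycS`, `cycP`
and `cycQ`. -/
theorem IsLyness.mem_of_invariant (h : IsLyness W) (hs : cycS W ∈ S) (hp : cycP W ∈ S)
    (hq : cycQ W ∈ S) {τ : R →ₐ[ℚ] R} (hτ : ∀ i, τ (W i) = W (i + 1)) (hS : ∀ c ∈ S, τ c = c)
    {r : R} (hr : r ∈ Algebra.adjoin ℚ (Set.range W)) (hi : τ r = r) : r ∈ S := by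
  have ht := trace_mem_of_mem_cycModule hs hp hτ hS (h.adjoin_le hs hp hq hr)
  simp only [hi] at ht
  have := S.smul_mem ht (1 / 5 : ℚ)
  rwa [show r + r + r + r + r = (5 : ℚ) • r by module, smul_smul,
    show (1 / 5 : ℚ) * 5 = 1 by norm_num, one_smul] at this

/-- The members of a Lyness cycle are integral over the algebra generated by `cycS`, `cycP`
and `cycQ`. -/
theorem IsLyness.isIntegral [IsDomain R] (h : IsLyness W) (hs : cycS W ∈ S) (hp : cycP W ∈ S)
    (hq : cycQ W ∈ S) (i : Fin 5) : IsIntegral S (W i) := by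
  refine isIntegral_of_smul_mem_submodule (cycModule S W) ?_ ?_ (W i)
    fun n hn ↦ h.mul_mem hs hp hq i hn
  · intro h0
    have := one_mem_cycModule (S := S) (W := W)
    rw [h0, Submodule.mem_bot] at this
    exact one_ne_zero this
  · exact Submodule.fg_span
      (((Set.finite_singleton _).union (Set.finite_range _)).union (Set.finite_range _))

end Lyness

/-! ### The surface in the coordinates `cycS`, `cycP`, `cycY` -/

section Field

variable {F : Type*} [Field F] {W : Fin 5 → F}

/-- Two members determine the cycle, so every identity between symmetric expressions becomes one of
rational functions in `W 0`, `W 1`. -/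
theorem IsLyness.eq_of_ne_zero (h : IsLyness W) (h3 : W 3 ≠ 0) :
    W 3 = W 0 * W 1 - 1 ∧ W 2 = (1 + W 0) / (W 0 * W 1 - 1) ∧
      W 4 = (1 + W 1) / (W 0 * W 1 - 1) := by
  have e0 := h 0
  have e1 := h 1
  have e3 := h 3
  simp only [Fin.reduceAdd, zero_add] at e0 e1 e3
  have e : W 3 = W 0 * W 1 - 1 := by linear_combination -e3
  rw [← e]
  refine ⟨rfl, ?_, ?_⟩
  · rw [eq_div_iff h3, e0]
  · rw [eq_div_iff h3, mul_comm, e1]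

theorem IsLyness.prod_eq (h : IsLyness W) (h3 : W 3 ≠ 0) : ∏ i, W i = cycS W + 3 := by
  obtain ⟨e3, e2, e4⟩ := h.eq_of_ne_zero h3
  rw [e3] at h3
  simp only [cycS, Fin.sum_univ_five, Fin.prod_univ_five]
  rw [e2, e3, e4]
  generalize W 0 = z at *
  generalize W 1 = w at *
  field_simp
  ring

/-- Since `cycQ` enters linearly, `cycY` can replace it as the third generator of the invariants. -/
theorem IsLyness.cycY_eq (h : IsLyness W) (h3 : W 3 ≠ 0) :
    cycY W = 2 * cycQ W + 2 * cycS W ^ 2 - 4 * cycP W - cycS W * cycP W - 15 := by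
  obtain ⟨e3, e2, e4⟩ := h.eq_of_ne_zero h3
  rw [e3] at h3
  simp only [cycS, cycP, cycQ, cycY, Fin.sum_univ_five, Fin.prod_univ_five, Fin.reduceAdd,
    zero_add]
  rw [e2, e3, e4]
  generalize W 0 = z at *
  generalize W 1 = w at *
  field_simp
  ring

theorem IsLyness.cycY_sq (h : IsLyness W) (h3 : W 3 ≠ 0) :
    cycY W ^ 2 = -4 * cycP W ^ 3 + (cycS W ^ 2 - 48 * cycS W - 140) * cycP W ^ 2 +
      (28 * cycS W ^ 3 + 48 * cycS W ^ 2 - 370 * cycS W - 800) * cycP W +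
      (-4 * cycS W ^ 5 - 4 * cycS W ^ 4 + 104 * cycS W ^ 3 + 160 * cycS W ^ 2 - 700 * cycS W
        - 1375) := by
  obtain ⟨e3, e2, e4⟩ := h.eq_of_ne_zero h3
  rw [e3] at h3
  simp only [cycS, cycP, cycY, Fin.sum_univ_five, Fin.prod_univ_five, Fin.reduceAdd, zero_add]
  rw [e2, e3, e4]
  generalize W 0 = z at *
  generalize W 1 = w at *
  field_simp
  ring

end Field

/-! ### Brackets of points of the projective line -/

/-- The bracket (determinant) of two vectors. -/
def br {R : Type*} [CommRing R] (v w : Fin 2 → R) : R := v 0 * w 1 - v 1 * w 0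

theorem br_smul_smul (a b : K) (v w : Fin 2 → K) : br (a • v) (b • w) = a * b * br v w := by
  simp [br]; ring

theorem br_mulVec (M : Matrix (Fin 2) (Fin 2) K) (v w : Fin 2 → K) :
    br (M.mulVec v) (M.mulVec w) = M.det * br v w := by
  simp [br, Matrix.mulVec, dotProduct, Fin.sum_univ_two, Matrix.det_fin_two]; ring

theorem exists_smul_of_br_eq_zero {v w : Fin 2 → K} (hw : w ≠ 0) (h : br v w = 0) :
    ∃ c : K, c • w = v := by
  rw [br] at h
  by_cases h0 : w 0 = 0
  · have h1 : w 1 ≠ 0 := fun h1 ↦ hw (funext fun i ↦ by fin_cases i <;> assumption)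
    refine ⟨v 1 / w 1, funext fun i ↦ ?_⟩
    fin_cases i
    · have : v 0 = 0 := by simpa [h0, h1] using h
      simp [h0, this]
    · simp [h1]
  · refine ⟨v 0 / w 0, funext fun i ↦ ?_⟩
    fin_cases i
    · simp [h0]
    · simp only [Fin.mk_one, Pi.smul_apply, smul_eq_mul]
      field_simp
      linear_combination h

theorem mk_eq_mk_of_br_eq_zero {v w : Fin 2 → K} (hv : v ≠ 0) (hw : w ≠ 0) (h : br v w = 0) :
    Projectivization.mk K v hv = Projectivization.mk K w hw :=
  (Projectivization.mk_eq_mk_iff' K v w hv hw).2 (exists_smul_of_br_eq_zero hw h)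

theorem br_eq_zero_of_mk_eq_mk {v w : Fin 2 → K} (hv : v ≠ 0) (hw : w ≠ 0)
    (h : Projectivization.mk K v hv = Projectivization.mk K w hw) : br v w = 0 := by
  obtain ⟨a, rfl⟩ := (Projectivization.mk_eq_mk_iff' K v w hv hw).1 h
  simp [br]; ring

theorem MTilde.br_ne_zero (x : MTilde) {i j : Fin 5} (h : i ≠ j) :
    br (x.p i).rep (x.p j).rep ≠ 0 := by
  intro hb
  refine h (x.inj ?_)
  rw [← (x.p i).mk_rep, ← (x.p j).mk_rep]
  exact mk_eq_mk_of_br_eq_zero _ _ hb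

/-! ### Cross-ratios -/

/-- The cross-ratio of four consecutive vectors in a cyclic sequence of five vectors. -/
def crossRatio (V : Fin 5 → Fin 2 → K) (i : Fin 5) : K :=
  br (V (i + 1)) (V (i + 2)) * br (V i) (V (i + 3)) /
    (br (V i) (V (i + 1)) * br (V (i + 2)) (V (i + 3)))

variable {V : Fin 5 → Fin 2 → K}

theorem crossRatio_ne_zero (hV : ∀ i j, i ≠ j → br (V i) (V j) ≠ 0) (i : Fin 5) :
    crossRatio V i ≠ 0 := by
  refine div_ne_zero (mul_ne_zero ?_ ?_) (mul_ne_zero ?_ ?_) <;> refine hV _ _ ?_ <;> simp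

/-- This is the three-term Plücker relation between the brackets of four vectors. It makes `1 +
crossRatio V i` a monomial in brackets, so the Lyness recurrence reduces to cancellation. -/
theorem one_add_crossRatio (hV : ∀ i j, i ≠ j → br (V i) (V j) ≠ 0) (i : Fin 5) :
    1 + crossRatio V i = br (V i) (V (i + 2)) * br (V (i + 1)) (V (i + 3)) /
      (br (V i) (V (i + 1)) * br (V (i + 2)) (V (i + 3))) := by
  have h1 := hV i (i + 1) (by simp)
  have h2 := hV (i + 2) (i + 3) (by simp)
  rw [crossRatio]
  field_simp
  simp only [br]
  ring

theorem isLyness_crossRatio (hV : ∀ i j, i ≠ j → br (V i) (V j) ≠ 0) :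
    IsLyness (crossRatio V) := by
  intro i
  have hs (v w : Fin 2 → K) : br v w = -br w v := by simp only [br]; ring
  have h1 := hV i (i + 1) (by simp)
  have h2 := hV (i + 2) (i + 3) (by simp)
  have h3 := hV (i + 3) (i + 4) (by simp)
  have h4 := hV (i + 4) i (by simp)
  rw [one_add_crossRatio hV]
  simp only [crossRatio, add_assoc, Fin.reduceAdd, add_zero]
  rw [hs (V (i + 2)) (V i), hs (V (i + 3)) (V (i + 1))]
  field_simp

theorem crossRatio_congr {V' : Fin 5 → Fin 2 → K} {d : K} (hd : d ≠ 0) {c : Fin 5 → K}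
    (hc : ∀ i, c i ≠ 0) (h : ∀ i j, br (V' i) (V' j) = c i * c j * d * br (V i) (V j)) :
    crossRatio V' = crossRatio V := by
  funext i
  have h1 := hc i
  have h2 := hc (i + 1)
  have h3 := hc (i + 2)
  have h4 := hc (i + 3)
  simp only [crossRatio, h]
  rw [show c (i + 1) * c (i + 2) * d * br (V (i + 1)) (V (i + 2)) *
      (c i * c (i + 3) * d * br (V i) (V (i + 3))) = (c i * c (i + 1) * c (i + 2) * c (i + 3) *
      d ^ 2) * (br (V (i + 1)) (V (i + 2)) * br (V i) (V (i + 3))) by ring,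
    show c i * c (i + 1) * d * br (V i) (V (i + 1)) *
      (c (i + 2) * c (i + 3) * d * br (V (i + 2)) (V (i + 3))) = (c i * c (i + 1) * c (i + 2) *
      c (i + 3) * d ^ 2) * (br (V i) (V (i + 1)) * br (V (i + 2)) (V (i + 3))) by ring]
  exact mul_div_mul_left _ _ (by positivity)

/-- The cross-ratios of four consecutive points of the cycle. -/
def lyn (x : MTilde) : Fin 5 → K := crossRatio fun i ↦ (x.p i).rep

theorem isLyness_lyn (x : MTilde) : IsLyness (lyn x) :=
  isLyness_crossRatio fun _ _ h ↦ x.br_ne_zero h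

theorem lyn_ne_zero (x : MTilde) (i : Fin 5) : lyn x i ≠ 0 :=
  crossRatio_ne_zero (fun _ _ h ↦ x.br_ne_zero h) i

theorem lyn_shift (x : MTilde) (i : Fin 5) : lyn (shift x) i = lyn x (i + 1) := by
  simp only [lyn, crossRatio, PeriodFive.shift, add_assoc, Fin.reduceAdd]

theorem exists_rep_smul (g : GL (Fin 2) K) (q : P1) :
    ∃ c : K, c ≠ 0 ∧ (Matrix.ProjGenLinGroup.mk g • q).rep = c • g.1.mulVec q.rep := by
  have h : Matrix.ProjGenLinGroup.mk g • q =
      Projectivization.mk K (g • q.rep) ((smul_ne_zero_iff_ne g).2 q.rep_nonzero) := by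
    conv_lhs => rw [← q.mk_rep]
    rfl
  obtain ⟨c, hc⟩ := Projectivization.exists_smul_eq_mk_rep K (g • q.rep)
    ((smul_ne_zero_iff_ne g).2 q.rep_nonzero)
  exact ⟨c, c.ne_zero, by rw [h, ← hc]; rfl⟩

theorem lyn_eq_of_sameOrbit {x y : MTilde} (h : SameOrbit x y) : lyn x = lyn y := by
  obtain ⟨g, -, hp⟩ := h
  obtain ⟨g, rfl⟩ := Matrix.ProjGenLinGroup.mk_surjective g
  choose c hc0 hc using fun i ↦ exists_rep_smul g (x.p i)
  refine (crossRatio_congr (d := g.1.det) ?_ hc0 fun i j ↦ ?_).symm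
  · exact (Matrix.isUnit_iff_isUnit_det _).1 g.isUnit |>.ne_zero
  · rw [hp, hp, hc, hc, br_smul_smul, br_mulVec]; ring

/-! ### Quadratic maps -/

theorem quad_smul (c : K) (a : Fin 6 → K) (v : Fin 2 → K) : quad (c • a) v = c • quad a v := by
  funext i; fin_cases i <;> simp [quad] <;> ring

theorem quad_vec_smul (c : K) (a : Fin 6 → K) (v : Fin 2 → K) :
    quad a (c • v) = c ^ 2 • quad a v := by
  funext i; fin_cases i <;> simp [quad] <;> ring

theorem End2.quad_ne_zero (f : End2) {a : Fin 6 → K} {ha : a ≠ 0}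
    (hf : f.1 = Projectivization.mk K a ha) {v : Fin 2 → K} (hv : v ≠ 0) : quad a v ≠ 0 := by
  obtain ⟨c, hc⟩ := Projectivization.exists_smul_eq_mk_rep K a ha
  intro h0
  have := f.2 v hv
  rw [hf, ← hc, Units.smul_def, quad_smul, h0] at this
  simp at this

theorem End2.eval_mk (f : End2) {a : Fin 6 → K} {ha : a ≠ 0}
    (hf : f.1 = Projectivization.mk K a ha) {v : Fin 2 → K} (hv : v ≠ 0) :
    f.eval (Projectivization.mk K v hv) =
      Projectivization.mk K (quad a v) (f.quad_ne_zero hf hv) := by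
  obtain ⟨c, hc⟩ := Projectivization.exists_smul_eq_mk_rep K a ha
  obtain ⟨b, hb⟩ := Projectivization.exists_smul_eq_mk_rep K v hv
  rw [End2.eval, Projectivization.mk_eq_mk_iff']
  refine ⟨c * b ^ 2, ?_⟩
  rw [hf, ← hc, ← hb, Units.smul_def, Units.smul_def, quad_smul, quad_vec_smul, smul_smul]

theorem exists_quad_conj (M N : Matrix (Fin 2) (Fin 2) K) (a : Fin 6 → K) :
    ∃ a' : Fin 6 → K, ∀ v, quad a' v = N.mulVec (quad a (M.mulVec v)) := by
  -- The coefficients of the two forms are transformed by the substitution `M`, then combined with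
  -- the rows of `N`.
  refine ⟨fun j ↦
    ![N 0 0, N 0 0, N 0 0, N 1 0, N 1 0, N 1 0] j *
      ![a 0 * M 0 0 ^ 2 + a 1 * M 0 0 * M 1 0 + a 2 * M 1 0 ^ 2,
        2 * a 0 * M 0 0 * M 0 1 + a 1 * (M 0 0 * M 1 1 + M 0 1 * M 1 0) + 2 * a 2 * M 1 0 * M 1 1,
        a 0 * M 0 1 ^ 2 + a 1 * M 0 1 * M 1 1 + a 2 * M 1 1 ^ 2,
        a 0 * M 0 0 ^ 2 + a 1 * M 0 0 * M 1 0 + a 2 * M 1 0 ^ 2,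
        2 * a 0 * M 0 0 * M 0 1 + a 1 * (M 0 0 * M 1 1 + M 0 1 * M 1 0) + 2 * a 2 * M 1 0 * M 1 1,
        a 0 * M 0 1 ^ 2 + a 1 * M 0 1 * M 1 1 + a 2 * M 1 1 ^ 2] j +
    ![N 0 1, N 0 1, N 0 1, N 1 1, N 1 1, N 1 1] j *
      ![a 3 * M 0 0 ^ 2 + a 4 * M 0 0 * M 1 0 + a 5 * M 1 0 ^ 2,
        2 * a 3 * M 0 0 * M 0 1 + a 4 * (M 0 0 * M 1 1 + M 0 1 * M 1 0) + 2 * a 5 * M 1 0 * M 1 1,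
        a 3 * M 0 1 ^ 2 + a 4 * M 0 1 * M 1 1 + a 5 * M 1 1 ^ 2,
        a 3 * M 0 0 ^ 2 + a 4 * M 0 0 * M 1 0 + a 5 * M 1 0 ^ 2,
        2 * a 3 * M 0 0 * M 0 1 + a 4 * (M 0 0 * M 1 1 + M 0 1 * M 1 0) + 2 * a 5 * M 1 0 * M 1 1,
        a 3 * M 0 1 ^ 2 + a 4 * M 0 1 * M 1 1 + a 5 * M 1 1 ^ 2] j, fun v ↦ ?_⟩
  funext i
  fin_cases i <;> simp [quad, Matrix.mulVec, dotProduct, Fin.sum_univ_two] <;> ring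

/-! ### A slice of the action of `PGL₂` -/

section Slice

variable {R : Type*} [CommRing R]

/-- Homogeneous coordinates of the five points of the normalized cycle with parameters `z`, `w`. -/
def sliceP (z w : R) : Fin 5 → Fin 2 → R :=
  ![![1 + z, 1], ![1, 0], ![0, 1], ![1, 1], ![1 + w, w]]

/-- The coefficients of the endomorphism with the normalized cycle `sliceP z w`. -/
def sliceA (z w : R) : Fin 6 → R :=
  ![0, (1 + w) * (1 + z) * (w + z * w + z ^ 2 * w - z ^ 2 * w ^ 2 - z),
    w * (1 + z) * (1 + w) * (z ^ 2 * w - 2 * z - 1),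
    w * z * (z * w ^ 2 - 2 * w - 1),
    w * (z * (1 + w) ^ 2 + (1 + z) ^ 2 * (1 + w - z * w ^ 2)),
    w * (1 + z) * (1 + w) * (z ^ 2 * w - 2 * z - 1)]

/-- The polynomial defining the complement of the set of admissible parameters. -/
def sliceB (z w : R) : R :=
  z * w * (1 + z) * (1 + w) * (z * w - 1) * (z - w) * (1 + w + z - z ^ 2 * w) *
    (1 + z + w - z * w ^ 2) * (z * w ^ 2 - 2 * w - 1) * (z ^ 2 * w - 2 * z - 1)

end Slice

/-- With `a 0 = 0` the first form splits into two linear factors. The resultant of the two forms is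
then `a 2 * a 3` times the expression in `hr`. -/
theorem quad_ne_zero_of_resultant {a : Fin 6 → K} (h0 : a 0 = 0) (h5 : a 5 = a 2) (h3 : a 3 ≠ 0)
    (h2 : a 2 ≠ 0) (hr : a 3 * a 2 - a 4 * a 1 + a 1 ^ 2 ≠ 0) {v : Fin 2 → K} (hv : v ≠ 0) :
    quad a v ≠ 0 := by
  intro h
  have e0 := congrFun h 0
  have e1 := congrFun h 1
  simp only [quad, h0, h5, Matrix.cons_val_zero, Matrix.cons_val_one, Pi.zero_apply] at e0 e1
  have e0' : v 1 * (a 1 * v 0 + a 2 * v 1) = 0 := by linear_combination e0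
  rcases mul_eq_zero.1 e0' with hv1 | hl
  · refine hv (funext fun i ↦ ?_)
    have hv0 : v 0 = 0 := by simpa [hv1, h3] using e1
    fin_cases i <;> assumption
  · by_cases hv1 : v 1 = 0
    · refine hv (funext fun i ↦ ?_)
      have hv0 : v 0 = 0 := by simpa [hv1, h3] using e1
      fin_cases i <;> assumption
    · refine mul_ne_zero (mul_ne_zero h2 hr) (pow_ne_zero 2 hv1) ?_
      linear_combination a 1 ^ 2 * e1 - (a 3 * (a 1 * v 0 - a 2 * v 1) + a 4 * a 1 * v 1) * hl

theorem sliceA_resultant (z w : K) :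
    sliceA z w 3 * sliceA z w 2 - sliceA z w 4 * sliceA z w 1 + sliceA z w 1 ^ 2 =
      -z * (z * w - 1) * (z - w) * (1 + w + z - z ^ 2 * w) * (1 + z + w - z * w ^ 2) := by
  simp [sliceA]; ring

theorem sliceP_ne_zero (z w : K) (i : Fin 5) : sliceP z w i ≠ 0 := by
  intro h
  have h0 := congrFun h 0
  have h1 := congrFun h 1
  fin_cases i <;> simp [sliceP] at h0 h1
  simp [h1] at h0

variable {z w : K}

theorem quad_sliceA_ne_zero (h : sliceB z w ≠ 0) {v : Fin 2 → K} (hv : v ≠ 0) :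
    quad (sliceA z w) v ≠ 0 := by
  simp only [sliceB, mul_ne_zero_iff] at h
  obtain ⟨⟨⟨⟨⟨⟨⟨⟨⟨hz, hw⟩, hz1⟩, hw1⟩, hzw⟩, hd⟩, hA⟩, hB⟩, hC⟩, hD⟩ := h
  refine quad_ne_zero_of_resultant (by simp [sliceA]) (by simp [sliceA]) ?_ ?_ ?_ hv
  · simpa [sliceA, hz, hw] using hC
  · simpa [sliceA, hz1, hw, hw1] using hD
  · rw [sliceA_resultant]
    simpa [hz, hzw, hd, hA] using hB

theorem br_quad_sliceA (i : Fin 5) :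
    br (quad (sliceA z w) (sliceP z w i)) (sliceP z w (i + 1)) = 0 := by
  fin_cases i <;> simp [br, quad, sliceA, sliceP] <;> ring

theorem br_sliceP_ne_zero (h : sliceB z w ≠ 0) {i j : Fin 5} (hij : i ≠ j) :
    br (sliceP z w i) (sliceP z w j) ≠ 0 := by
  simp only [sliceB, mul_ne_zero_iff] at h
  obtain ⟨⟨⟨⟨⟨⟨⟨⟨⟨hz, hw⟩, hz1⟩, hw1⟩, hzw⟩, hd⟩, hA⟩, hB⟩, hC⟩, hD⟩ := h
  have e : (1 + z) * w - (1 + w) ≠ 0 := by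
    convert hzw using 1; ring
  have e' : 1 + w - w * (1 + z) ≠ 0 := by
    contrapose! e; linear_combination -e
  fin_cases i <;> fin_cases j <;> simp [br, sliceP] at hij ⊢ <;>
    first
    | assumption
    | exact fun h0 ↦ hz1 (by linear_combination -h0)
    | exact fun h0 ↦ hw1 (by linear_combination -h0)

theorem sliceA_ne_zero (h : sliceB z w ≠ 0) : sliceA z w ≠ 0 := by
  intro h0
  refine quad_sliceA_ne_zero h (sliceP_ne_zero z w 0) ?_
  rw [h0]
  simpa using quad_smul 0 0 (sliceP z w 0)

/-- The endomorphism with normalized cycle `sliceP z w`. -/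
def sliceF (z w : K) (h : sliceB z w ≠ 0) : End2 :=
  ⟨Projectivization.mk K (sliceA z w) (sliceA_ne_zero h), fun v hv ↦ by
    obtain ⟨c, hc⟩ := Projectivization.exists_smul_eq_mk_rep K (sliceA z w) (sliceA_ne_zero h)
    rw [← hc, Units.smul_def, quad_smul]
    exact smul_ne_zero c.ne_zero (quad_sliceA_ne_zero h hv)⟩

/-- The normalized points of `M̃₂(5)`. -/
def slice (z w : K) (h : sliceB z w ≠ 0) : MTilde where
  f := sliceF z w h
  p i := Projectivization.mk K (sliceP z w i) (sliceP_ne_zero z w i)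
  inj i j hij := by
    by_contra hne
    exact br_sliceP_ne_zero h hne (br_eq_zero_of_mk_eq_mk _ _ hij)
  cycle i := by
    rw [(sliceF z w h).eval_mk rfl]
    exact mk_eq_mk_of_br_eq_zero _ _ (br_quad_sliceA i)

theorem crossRatio_sliceP : crossRatio (sliceP z w) 0 = z ∧
    (w ≠ 0 → crossRatio (sliceP z w) 1 = w) := by
  refine ⟨by simp [crossRatio, br, sliceP], fun hw ↦ by simp [crossRatio, br, sliceP]⟩

theorem exists_slice_coord (h : sliceB z w ≠ 0) :
    ∃ (a : K) (c : Fin 5 → K), a ≠ 0 ∧ (∀ i, c i ≠ 0) ∧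
      (slice z w h).f.1.rep = a • sliceA z w ∧
      ∀ i, ((slice z w h).p i).rep = c i • sliceP z w i := by
  obtain ⟨a, ha⟩ := Projectivization.exists_smul_eq_mk_rep K (sliceA z w) (sliceA_ne_zero h)
  choose c hc using fun i ↦ Projectivization.exists_smul_eq_mk_rep K (sliceP z w i)
    (sliceP_ne_zero z w i)
  exact ⟨a, fun i ↦ c i, a.ne_zero, fun i ↦ (c i).ne_zero, ha.symm, fun i ↦ (hc i).symm⟩

theorem lyn_slice (h : sliceB z w ≠ 0) : lyn (slice z w h) = crossRatio (sliceP z w) := by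
  obtain ⟨-, c, -, hc0, -, hc⟩ := exists_slice_coord h
  refine crossRatio_congr one_ne_zero hc0 fun i j ↦ ?_
  rw [hc, hc, br_smul_smul, mul_one]

theorem lyn_slice_zero (h : sliceB z w ≠ 0) : lyn (slice z w h) 0 = z := by
  rw [lyn_slice, crossRatio_sliceP.1]

theorem lyn_slice_one (h : sliceB z w ≠ 0) : lyn (slice z w h) 1 = w := by
  rw [lyn_slice, crossRatio_sliceP.2]
  rintro rfl
  simp [sliceB] at h

/-- An endomorphism of degree two with normalized cycle `sliceP z w` has coefficients
`sliceA z w`, and the parameters are admissible. -/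
theorem eq_smul_sliceA {a : Fin 6 → K} (hz : z ≠ 0) (hw : w ≠ 0) (hz1 : 1 + z ≠ 0)
    (hw1 : 1 + w ≠ 0) (hzw : z * w - 1 ≠ 0) (hnr : ∀ v, v ≠ 0 → quad a v ≠ 0)
    (hc : ∀ i, br (quad a (sliceP z w i)) (sliceP z w (i + 1)) = 0) :
    sliceB z w ≠ 0 ∧ ∃ l : K, l ≠ 0 ∧ a = l • sliceA z w := by
  have c0 := hc 0
  have c1 := hc 1
  have c2 := hc 2
  have c3 := hc 3
  have c4 := hc 4
  simp [br, quad, sliceP] at c0 c1 c2 c3 c4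
  have h5 : a 5 = a 2 := by linear_combination -c2
  have h3 : a 3 ≠ 0 := by
    intro h3
    refine hnr ![1, 0] (by simp) ?_
    funext i; fin_cases i <;> simp [quad, c1, h3]
  have h2 : a 2 ≠ 0 := by
    intro h2
    refine hnr ![0, 1] (by simp) ?_
    funext i; fin_cases i <;> simp [quad, h5, h2]
  rw [c1, h5] at c3
  rw [c1, h5] at c4
  rw [h5] at c0
  have hr : a 3 * a 2 - a 4 * a 1 + a 1 ^ 2 ≠ 0 := by
    intro hr
    -- This vector is the root of the linear factor `a 1 * u + a 2 * v` of the first form.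
    refine hnr ![-a 2, a 1] (fun h0 ↦ h2 (by simpa using congrFun h0 0)) ?_
    funext i
    fin_cases i
    · simp [quad, c1]; ring
    · simp [quad, h5]; linear_combination a 2 * hr
  -- The steps `∞ ↦ 0 ↦ 1` of the cycle gave `a 0 = 0` and `a 5 = a 2`. The other three conditions
  -- are solved linearly in terms of `a 3`, which yields the entries of `sliceA`.
  have e2 : a 2 = -(1 + z) * ((1 + z) * a 3 + a 4) := by linear_combination -c0
  have e1 : w * a 1 = (1 + w) * (a 3 + a 4) + a 2 := by linear_combination c3
  have e4 : z * (z * w ^ 2 - 2 * w - 1) * a 4 =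
      (z * (1 + w) ^ 2 + (1 + z) ^ 2 * (1 + w - z * w ^ 2)) * a 3 := by
    linear_combination c4 - (1 + w) * e1 - (1 + w - z * w ^ 2) * e2
  -- The linear system can only degenerate at `z = w` with `z ^ 2 = z + 1`, where the five points
  -- are fixed up to `PGL₂` by the rotation. There every solution has vanishing resultant, so it is
  -- not of degree two.
  have hE : z * w ^ 2 - 2 * w - 1 ≠ 0 := by
    intro hE
    rw [hE, mul_zero, zero_mul, eq_comm, mul_eq_zero, or_iff_left h3] at e4
    have hd : (z - w) * (z * w - 1) = 0 := by linear_combination -e4 - (1 + z) ^ 2 * hE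
    obtain rfl : z = w := by
      rcases mul_eq_zero.1 hd with h | h
      · exact sub_eq_zero.1 h
      · exact absurd h hzw
    have hg : z ^ 2 = z + 1 := by
      refine mul_left_cancel₀ hz1 ?_
      linear_combination hE
    have e1' : a 1 = -z ^ 2 * a 3 := by
      refine mul_left_cancel₀ hz ?_
      linear_combination e1 + e2 + z * a 3 * hg
    refine hr ?_
    rw [e1', e2]
    linear_combination (a 3 * a 4 + a 3 ^ 2 * (z ^ 2 + z + 1)) * hg
  obtain ⟨l, hl⟩ : ∃ l, l = a 3 / (w * z * (z * w ^ 2 - 2 * w - 1)) := ⟨_, rfl⟩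
  have hl0 : l ≠ 0 := by
    rw [hl]
    exact div_ne_zero h3 (mul_ne_zero (mul_ne_zero hw hz) hE)
  have ha : a = l • sliceA z w := by
    funext j
    have hden : w * z * (z * w ^ 2 - 2 * w - 1) ≠ 0 := mul_ne_zero (mul_ne_zero hw hz) hE
    rw [Pi.smul_apply, smul_eq_mul, hl, div_mul_eq_mul_div, eq_div_iff hden]
    fin_cases j <;> simp only [sliceA, Fin.zero_eta, Fin.mk_one, Fin.reduceFinMk, Matrix.cons_val]
    · rw [c1]; ring
    · linear_combination z * (z * w ^ 2 - 2 * w - 1) * e1 + (w - z) * e4 +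
        z * (z * w ^ 2 - 2 * w - 1) * e2
    · linear_combination w * (z * (z * w ^ 2 - 2 * w - 1) * e2 - (1 + z) * e4)
    · linear_combination w * e4
    · rw [h5]
      linear_combination w * (z * (z * w ^ 2 - 2 * w - 1) * e2 - (1 + z) * e4)
  refine ⟨?_, l, hl0, ha⟩
  have hr' : l ^ 2 * (sliceA z w 3 * sliceA z w 2 - sliceA z w 4 * sliceA z w 1 +
      sliceA z w 1 ^ 2) ≠ 0 := by
    convert hr using 1
    rw [ha]
    simp only [Pi.smul_apply, smul_eq_mul]
    ring
  rw [sliceA_resultant] at hr'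
  have h2' := h2
  rw [ha, Pi.smul_apply, smul_eq_mul] at h2'
  simp only [sliceA, Matrix.cons_val, mul_ne_zero_iff] at h2'
  simp only [mul_ne_zero_iff] at hr'
  simp only [sliceB, mul_ne_zero_iff]
  exact ⟨⟨⟨⟨⟨⟨⟨⟨⟨hz, hw⟩, hz1⟩, hw1⟩, hzw⟩, hr'.2.1.1.2⟩, hr'.2.1.2⟩, hr'.2.2⟩, hE⟩, h2'.2.2⟩

/-- The matrix that moves the lines of `v₁`, `v₂`, `v₃` to `∞`, `0`, `1`. -/
def normalizer (v₁ v₂ v₃ : Fin 2 → K) : Matrix (Fin 2) (Fin 2) K :=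
  !![-br v₁ v₃ * v₂ 1, br v₁ v₃ * v₂ 0; -br v₂ v₃ * v₁ 1, br v₂ v₃ * v₁ 0]

theorem normalizer_mulVec (v₁ v₂ v₃ v : Fin 2 → K) :
    (normalizer v₁ v₂ v₃).mulVec v = ![br v₁ v₃ * br v₂ v, br v₂ v₃ * br v₁ v] := by
  funext i
  fin_cases i <;> simp [normalizer, Matrix.mulVec, dotProduct, Fin.sum_univ_two, br] <;> ring

theorem det_normalizer (v₁ v₂ v₃ : Fin 2 → K) :
    (normalizer v₁ v₂ v₃).det = br v₁ v₂ * br v₁ v₃ * -br v₂ v₃ := by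
  simp [normalizer, Matrix.det_fin_two, br]; ring

theorem exists_normalizer_mulVec (hV : ∀ i j, i ≠ j → br (V i) (V j) ≠ 0) (i : Fin 5) :
    ∃ c : K, c ≠ 0 ∧ (normalizer (V 1) (V 2) (V 3)).mulVec (V i) =
      c • sliceP (crossRatio V 0) (crossRatio V 1) i := by
  have h01 := hV 0 1 (by decide)
  have h23 := hV 2 3 (by decide)
  have h12 := hV 1 2 (by decide)
  have h34 := hV 3 4 (by decide)
  have h13 := hV 1 3 (by decide)
  have h14 := hV 1 4 (by decide)
  have a0 := one_add_crossRatio hV 0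
  have a1 := one_add_crossRatio hV 1
  have b1 : crossRatio V 1 = br (V 2) (V 3) * br (V 1) (V 4) /
      (br (V 1) (V 2) * br (V 3) (V 4)) := rfl
  simp only [Fin.reduceAdd, zero_add] at a0 a1
  have hs (v w : Fin 2 → K) : br v w = -br w v := by simp only [br]; ring
  have hv (v : Fin 2 → K) : br v v = 0 := by simp only [br]; ring
  simp only [normalizer_mulVec]
  fin_cases i
  · refine ⟨-(br (V 0) (V 1) * br (V 2) (V 3)), by simp [h01, h23], ?_⟩
    funext j
    fin_cases j
    · simp only [sliceP, a0, Fin.zero_eta, Matrix.cons_val, Pi.smul_apply, smul_eq_mul]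
      rw [hs (V 2) (V 0)]
      field_simp
    · simp only [sliceP, Fin.zero_eta, Fin.mk_one, Matrix.cons_val, Pi.smul_apply, smul_eq_mul]
      rw [hs (V 1) (V 0)]
      ring
  · refine ⟨-(br (V 1) (V 3) * br (V 1) (V 2)), by simp [h13, h12], ?_⟩
    funext j
    fin_cases j
    · simp [sliceP, hs (V 2) (V 1)]
    · simp [sliceP, hv]
  · refine ⟨br (V 2) (V 3) * br (V 1) (V 2), by simp [h23, h12], ?_⟩
    funext j
    fin_cases j
    · simp [sliceP, hv]
    · simp [sliceP]
  · refine ⟨br (V 2) (V 3) * br (V 1) (V 3), by simp [h23, h13], ?_⟩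
    funext j
    fin_cases j
    · simp [sliceP, mul_comm]
    · simp [sliceP]
  · refine ⟨br (V 1) (V 2) * br (V 3) (V 4), by simp [h12, h34], ?_⟩
    funext j
    fin_cases j
    · simp only [sliceP, a1, Fin.zero_eta, Fin.reduceFinMk, Matrix.cons_val, Pi.smul_apply,
        smul_eq_mul]
      field_simp
    · simp only [sliceP, b1, Fin.mk_one, Fin.reduceFinMk, Matrix.cons_val, Pi.smul_apply,
        smul_eq_mul]
      field_simp

theorem MTilde.br_quad (x : MTilde) (i : Fin 5) :
    br (quad x.f.1.rep (x.p i).rep) (x.p (i + 1)).rep = 0 := by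
  have h := x.cycle i
  rw [End2.eval, ← (x.p (i + 1)).mk_rep] at h
  exact br_eq_zero_of_mk_eq_mk _ _ h

/-- Every point of `M̃₂(5)` lies in the orbit of a normalized one. -/
theorem exists_sameOrbit_slice (x : MTilde) :
    ∃ h : sliceB (lyn x 0) (lyn x 1) ≠ 0, SameOrbit x (slice (lyn x 0) (lyn x 1) h) := by
  obtain ⟨V, hVdef⟩ : ∃ V : Fin 5 → Fin 2 → K, V = fun i ↦ (x.p i).rep := ⟨_, rfl⟩
  have hV (i j : Fin 5) (h : i ≠ j) : br (V i) (V j) ≠ 0 := by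
    rw [hVdef]; exact x.br_ne_zero h
  have hlyn : lyn x = crossRatio V := by rw [hVdef]; rfl
  rw [hlyn]
  obtain ⟨N, hN⟩ : ∃ N, N = normalizer (V 1) (V 2) (V 3) := ⟨_, rfl⟩
  have hdet : N.det ≠ 0 := by
    rw [hN, det_normalizer]
    exact mul_ne_zero (mul_ne_zero (hV _ _ (by decide)) (hV _ _ (by decide)))
      (neg_ne_zero.2 (hV _ _ (by decide)))
  obtain ⟨a, ha⟩ := exists_quad_conj N⁻¹ N x.f.1.rep
  have hinv (v : Fin 2 → K) : N⁻¹.mulVec (N.mulVec v) = v := by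
    rw [Matrix.mulVec_mulVec, Matrix.nonsing_inv_mul _ hdet.isUnit, Matrix.one_mulVec]
  have hinv' (v : Fin 2 → K) : N.mulVec (N⁻¹.mulVec v) = v := by
    rw [Matrix.mulVec_mulVec, Matrix.mul_nonsing_inv _ hdet.isUnit, Matrix.one_mulVec]
  have hconj (v : Fin 2 → K) : quad a (N.mulVec v) = N.mulVec (quad x.f.1.rep v) := by
    rw [ha, hinv]
  choose c hc0 hc using exists_normalizer_mulVec hV
  rw [← hN] at hc
  have hL := isLyness_crossRatio hV
  have hW := crossRatio_ne_zero hV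
  have h3 := hL.eq_of_ne_zero (hW 3)
  have h1 (i : Fin 5) : 1 + crossRatio V i ≠ 0 := by
    rw [← hL i]; exact mul_ne_zero (hW _) (hW _)
  obtain ⟨hB, l, hl0, hl⟩ := eq_smul_sliceA (a := a) (hW 0) (hW 1) (h1 0) (h1 1)
    (h3.1 ▸ hW 3) (fun v hv h0 ↦ by
      rw [ha] at h0
      have hv' : N⁻¹.mulVec v ≠ 0 := fun h ↦ hv (by rw [← hinv' v, h, Matrix.mulVec_zero])
      refine x.f.2 _ hv' ?_
      rw [← hinv (quad _ _), h0, Matrix.mulVec_zero])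
    (fun i ↦ by
      have e := br_mulVec N (quad x.f.1.rep (V i)) (V (i + 1))
      have e' : br (quad x.f.1.rep (V i)) (V (i + 1)) = 0 := by rw [hVdef]; exact x.br_quad i
      rw [← hconj, hc, hc, quad_vec_smul, br_smul_smul, e', mul_zero] at e
      simpa [hc0] using e)
  obtain ⟨g, hg⟩ : ∃ g : GL (Fin 2) K, g.1 = N :=
    ⟨Matrix.GeneralLinearGroup.mkOfDetNeZero N hdet, rfl⟩
  have e1 (v : Fin 2 → K) (hv : v ≠ 0) : Matrix.ProjGenLinGroup.mk g •
      Projectivization.mk K v hv = Projectivization.mk K (N.mulVec v)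
      (fun h ↦ hv (by rw [← hinv v, h, Matrix.mulVec_zero])) := by
    subst hg; rfl
  refine ⟨hB, Matrix.ProjGenLinGroup.mk g, fun q ↦ ?_, fun i ↦ ?_⟩
  · have e0 : x.f.eval q = Projectivization.mk K (quad x.f.1.rep q.rep)
      (x.f.2 _ q.rep_nonzero) := rfl
    rw [e0, e1]
    conv_lhs => rw [← q.mk_rep, e1]
    rw [show (slice _ _ hB).f = sliceF _ _ hB from rfl, (sliceF _ _ hB).eval_mk rfl,
      Projectivization.mk_eq_mk_iff']
    refine ⟨l⁻¹, ?_⟩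
    rw [← hconj, hl, quad_smul, smul_smul, inv_mul_cancel₀ hl0, one_smul]
  · conv_rhs => rw [← (x.p i).mk_rep, e1]
    rw [show (slice _ _ hB).p i = Projectivization.mk K (sliceP _ _ i) (sliceP_ne_zero _ _ i)
      from rfl, Projectivization.mk_eq_mk_iff']
    refine ⟨(c i)⁻¹, ?_⟩
    rw [show (x.p i).rep = V i by rw [hVdef], hc, smul_smul, inv_mul_cancel₀ (hc0 i), one_smul]

/-! ### Rescaling of multihomogeneous coordinates -/

open MvPolynomial in
/-- A weighted homogeneous polynomial scales by a character of the group of weights. -/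
theorem aeval_of_isWeightedHomogeneous {ι M k F : Type*} [Fintype ι] [AddCommMonoid M]
    [CommRing k] [CommRing F] [Algebra k F] {wt : ι → M} {m : M} {P : MvPolynomial ι k}
    (hP : P.IsWeightedHomogeneous wt m) (χ : Multiplicative M →* F) (x : ι → F) :
    aeval (fun c ↦ χ (.ofAdd (wt c)) * x c) P = χ (.ofAdd m) * aeval x P := by
  rw [aeval_def, aeval_def, eval₂_eq', eval₂_eq', Finset.mul_sum]
  refine Finset.sum_congr rfl fun d hd ↦ ?_
  have e : ∏ c, χ (.ofAdd (wt c)) ^ d c = χ (.ofAdd m) := by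
    rw [← hP (mem_support_iff.1 hd), Finsupp.weight_apply, Finsupp.sum_fintype _ _ (by simp),
      ofAdd_sum, map_prod]
    simp only [ofAdd_nsmul, map_pow]
  simp only [mul_pow, Finset.prod_mul_distrib, e]
  ring

/-- The character of the group of multidegrees with given values on the generators. -/
def degChar (a : K) (c : Fin 5 → K) : Multiplicative (ℕ × (Fin 5 → ℕ)) →* K where
  toFun m := a ^ m.toAdd.1 * ∏ i, c i ^ m.toAdd.2 i
  map_one' := by simp
  map_mul' m n := by
    simp only [toAdd_mul, Prod.fst_add, Prod.snd_add, Pi.add_apply, pow_add,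
      Finset.prod_mul_distrib]
    ring

theorem degChar_ne_zero {a : K} {c : Fin 5 → K} (ha : a ≠ 0) (hc : ∀ i, c i ≠ 0)
    (m : Multiplicative (ℕ × (Fin 5 → ℕ))) : degChar a c m ≠ 0 :=
  mul_ne_zero (pow_ne_zero _ ha) (Finset.prod_ne_zero_iff.2 fun i _ ↦ pow_ne_zero _ (hc i))

theorem degChar_inl (a : K) (c : Fin 5 → K) (j : Fin 6) :
    degChar a c (.ofAdd (multideg (.inl j))) = a := by
  simp [degChar, multideg]

theorem degChar_inr (a : K) (c : Fin 5 → K) (i : Fin 5) (k : Fin 2) :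
    degChar a c (.ofAdd (multideg (.inr (i, k)))) = c i := by
  simp only [degChar, multideg, MonoidHom.coe_mk, OneHom.coe_mk, toAdd_ofAdd, pow_zero, one_mul]
  rw [Finset.prod_eq_single i (fun j _ hj ↦ by simp [hj]) (by simp)]
  simp

/-! ### Regular functions -/

/-- The bracket of two of the points of the cycle, as a polynomial in the coordinates. -/
def brPoly (i j : Fin 5) : MvPolynomial Coord ℚ :=
  .X (.inr (i, 0)) * .X (.inr (j, 1)) - .X (.inr (i, 1)) * .X (.inr (j, 0))

/-- The multidegree of the coordinates of a point of the cycle. -/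
def pointDeg (i : Fin 5) : ℕ × (Fin 5 → ℕ) := (0, Pi.single i 1)

theorem isWeightedHomogeneous_brPoly (i j : Fin 5) :
    (brPoly i j).IsWeightedHomogeneous multideg (pointDeg i + pointDeg j) := by
  have hX (i : Fin 5) (k : Fin 2) : (MvPolynomial.X (.inr (i, k)) :
      MvPolynomial Coord ℚ).IsWeightedHomogeneous multideg (pointDeg i) :=
    MvPolynomial.isWeightedHomogeneous_X ℚ multideg (.inr (i, k))
  exact Submodule.sub_mem (MvPolynomial.weightedHomogeneousSubmodule ℚ multideg _)
    ((hX i 0).mul (hX j 1)) ((hX i 1).mul (hX j 0))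

theorem aeval_brPoly (x : MTilde) (i j : Fin 5) :
    MvPolynomial.aeval x.coord (brPoly i j) = br (x.p i).rep (x.p j).rep := by
  simp [brPoly, br, MTilde.coord]

theorem lyn_mem (i : Fin 5) : (fun x ↦ lyn x i) ∈ coordRingM := by
  refine ⟨fun x ↦ ?_, fun x y h ↦ congrFun (lyn_eq_of_sameOrbit h) i⟩
  refine ⟨_, _, brPoly i (i + 1) * brPoly (i + 2) (i + 3),
    (isWeightedHomogeneous_brPoly (i + 1) (i + 2)).mul (isWeightedHomogeneous_brPoly i (i + 3)),
    ?_, ?_, fun y _ ↦ ?_⟩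
  · convert (isWeightedHomogeneous_brPoly i (i + 1)).mul
      (isWeightedHomogeneous_brPoly (i + 2) (i + 3)) using 1
    abel
  · rw [map_mul, aeval_brPoly, aeval_brPoly]
    exact mul_ne_zero (x.br_ne_zero (by simp)) (x.br_ne_zero (by simp))
  · simp only [map_mul, aeval_brPoly]
    rfl

/-- A nowhere vanishing regular function is invertible. -/
theorem inv_mem_coordRingM {h : MTilde → K} (H : h ∈ coordRingM) (h0 : ∀ x, h x ≠ 0) :
    h⁻¹ ∈ coordRingM := by
  refine ⟨fun x ↦ ?_, fun x y r ↦ congrArg (·⁻¹) (H.2 x y r)⟩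
  obtain ⟨m, P, Q, hP, hQ, hx, e⟩ := H.1 x
  -- The extra factor `Q` in the denominator keeps to the locus where `h = P / Q` is known.
  refine ⟨m + m, Q * Q, P * Q, hQ.mul hQ, hP.mul hQ, ?_, fun y hy ↦ ?_⟩
  · have hx' := h0 x
    rw [e x hx] at hx'
    rw [map_mul]
    exact mul_ne_zero (div_ne_zero_iff.1 hx').1 hx
  · rw [map_mul] at hy
    have hQy := right_ne_zero_of_mul hy
    rw [Pi.inv_apply, e y hQy, map_mul, map_mul, mul_div_mul_right _ _ hQy, inv_div]

section Slice

variable {R : Type*} [CommRing R]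

/-- Homogeneous coordinates of the normalized point with parameters `z`, `w`. -/
def sliceCoord (z w : R) : Coord → R
  | .inl j => sliceA z w j
  | .inr (i, k) => sliceP z w i k

theorem map_sliceCoord {R' : Type*} [CommRing R'] (φ : R →+* R') (z w : R) (c : Coord) :
    φ (sliceCoord z w c) = sliceCoord (φ z) (φ w) c := by
  rcases c with j | ⟨i, k⟩
  · fin_cases j <;> simp [sliceCoord, sliceA, map_ofNat φ 2]
  · fin_cases i <;> fin_cases k <;> simp [sliceCoord, sliceP]

theorem map_sliceB {R' : Type*} [CommRing R'] (φ : R →+* R') (z w : R) :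
    φ (sliceB z w) = sliceB (φ z) (φ w) := by
  simp [sliceB, map_ofNat φ 2]

end Slice

open MvPolynomial

/-- The chosen representatives differ from `sliceCoord` by one scalar per projective factor. The
resulting `t` depends only on the multidegree, so it cancels in quotients. -/
theorem exists_aeval_coord_slice {z w : K} (h : sliceB z w ≠ 0) {m : ℕ × (Fin 5 → ℕ)} :
    ∃ t : K, t ≠ 0 ∧ ∀ P : MvPolynomial Coord ℚ, P.IsWeightedHomogeneous multideg m →
      aeval (slice z w h).coord P = t * aeval (sliceCoord z w) P := by
  obtain ⟨a, c, ha0, hc0, ha, hc⟩ := exists_slice_coord h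
  refine ⟨degChar a c (.ofAdd m), degChar_ne_zero ha0 hc0 _, fun P hP ↦ ?_⟩
  rw [← aeval_of_isWeightedHomogeneous hP]
  congr 2
  funext d
  rcases d with j | ⟨i, k⟩
  · rw [degChar_inl, MTilde.coord, ha]; rfl
  · rw [degChar_inr, MTilde.coord, hc]; rfl

/-- The ideal of denominators of a function on the admissible parameters. -/
def denomIdeal (h : MTilde → K) : Ideal (MvPolynomial (Fin 2) ℚ) where
  carrier := {r | ∃ P : MvPolynomial (Fin 2) ℚ, ∀ (t : Fin 2 → K) (ht : sliceB (t 0) (t 1) ≠ 0),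
    aeval t r * h (slice (t 0) (t 1) ht) = aeval t P}
  add_mem' := by
    rintro r₁ r₂ ⟨P₁, h₁⟩ ⟨P₂, h₂⟩
    exact ⟨P₁ + P₂, fun t ht ↦ by rw [map_add, map_add, add_mul, h₁, h₂]⟩
  zero_mem' := ⟨0, fun t ht ↦ by rw [map_zero, zero_mul]⟩
  smul_mem' := by
    rintro r₁ r₂ ⟨P, h⟩
    exact ⟨r₁ * P, fun t ht ↦ by rw [smul_eq_mul, map_mul, map_mul, mul_assoc, h]⟩

theorem aeval_sliceB (t : Fin 2 → K) :
    aeval t (sliceB (X 0 : MvPolynomial (Fin 2) ℚ) (X 1)) = sliceB (t 0) (t 1) := by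
  have := map_sliceB (aeval t : MvPolynomial (Fin 2) ℚ →ₐ[ℚ] K).toRingHom (X 0) (X 1)
  simpa using this

theorem aeval_sliceCoord (t : Fin 2 → K) (P : MvPolynomial Coord ℚ) :
    aeval t (aeval (sliceCoord (X 0 : MvPolynomial (Fin 2) ℚ) (X 1)) P) =
      aeval (sliceCoord (t 0) (t 1)) P := by
  rw [← AlgHom.comp_apply, comp_aeval]
  congr 2
  funext c
  have := map_sliceCoord (aeval t : MvPolynomial (Fin 2) ℚ →ₐ[ℚ] K).toRingHom (X 0) (X 1) c
  simpa using this

/-- An invariant regular function is a polynomial in two consecutive cross-ratios, up to a power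
of `sliceB`. -/
theorem exists_sliceB_pow_mul_eq {h : MTilde → K} (H : h ∈ coordRingM) :
    ∃ (n : ℕ) (P : MvPolynomial (Fin 2) ℚ), ∀ x : MTilde,
      sliceB (lyn x 0) (lyn x 1) ^ n * h x = aeval ![lyn x 0, lyn x 1] P := by
  -- By the Nullstellensatz it suffices that at each admissible parameter some denominator of `h`
  -- does not vanish.
  have hmem : sliceB (X 0 : MvPolynomial (Fin 2) ℚ) (X 1) ∈ (denomIdeal h).radical := by
    rw [← vanishingIdeal_zeroLocus_eq_radical (K := K)]
    intro t ht
    rw [aeval_sliceB]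
    by_contra hB
    obtain ⟨m, P, Q, hP, hQ, hx, e⟩ := H.1 (slice (t 0) (t 1) hB)
    obtain ⟨a, ha0, ha⟩ := exists_aeval_coord_slice hB (m := m)
    rw [ha Q hQ] at hx
    refine mul_ne_zero (right_ne_zero_of_mul hx) (right_ne_zero_of_mul hx) ?_
    rw [← aeval_sliceCoord, ← map_mul]
    -- The denominator is the square of `Q` on the slice: `Q² h = Q P` also holds where `Q`
    -- vanishes, although nothing is known there about `Q h`.
    refine ht _ ⟨aeval (sliceCoord (X 0) (X 1)) (Q * P), fun t' ht' ↦ ?_⟩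
    simp only [map_mul, aeval_sliceCoord]
    by_cases hQ0 : aeval (sliceCoord (t' 0) (t' 1)) Q = 0
    · simp [hQ0]
    · obtain ⟨a', ha0', ha'⟩ := exists_aeval_coord_slice ht' (m := m)
      rw [e _ (by rw [ha' Q hQ]; exact mul_ne_zero ha0' hQ0), ha' Q hQ, ha' P hP]
      field_simp
  obtain ⟨n, P, hn⟩ := hmem
  refine ⟨n, P, fun x ↦ ?_⟩
  obtain ⟨hB, ho⟩ := exists_sameOrbit_slice x
  have := hn ![lyn x 0, lyn x 1] hB
  rw [map_pow, aeval_sliceB] at this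
  rw [H.2 _ _ ho]
  exact this

/-- Two consecutive cross-ratios take all admissible values. -/
theorem eq_zero_of_aeval_lyn {P : MvPolynomial (Fin 2) ℚ}
    (hP : ∀ x : MTilde, aeval ![lyn x 0, lyn x 1] P = 0) : P = 0 := by
  have hB0 : sliceB (X 0 : MvPolynomial (Fin 2) ℚ) (X 1) ≠ 0 := by
    intro h0
    have := congrArg (aeval ![(2 : K), 3]) h0
    rw [aeval_sliceB] at this
    norm_num [sliceB] at this
  have hmul : sliceB (X 0 : MvPolynomial (Fin 2) ℚ) (X 1) * P = 0 := by
    apply map_injective (algebraMap ℚ K) (algebraMap ℚ K).injective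
    rw [map_zero]
    refine funext fun t ↦ ?_
    rw [map_zero, eval_map, ← aeval_def, map_mul, aeval_sliceB]
    by_cases hB : sliceB (t 0) (t 1) = 0
    · rw [hB, zero_mul]
    · have := hP (slice (t 0) (t 1) hB)
      rw [lyn_slice_zero, lyn_slice_one] at this
      have ht : ![t 0, t 1] = t := by funext i; fin_cases i <;> rfl
      rw [ht] at this
      rw [this, mul_zero]
  exact (mul_eq_zero.1 hmul).resolve_left hB0

/-! ### Birationality from inclusions of rings -/

section Birational

open AlgebraicGeometry CategoryTheory

theorem isDominant_specMap {R S : Type} [CommRing R] [CommRing S] (φ : R →+* S)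
    (h : Function.Injective φ) : IsDominant (Spec.map (CommRingCat.ofHom φ)) := by
  refine ⟨?_⟩
  change DenseRange (PrimeSpectrum.comap φ)
  rw [PrimeSpectrum.denseRange_comap_iff_ker_le_nilRadical,
    (RingHom.injective_iff_ker_eq_bot φ).1 h]
  exact bot_le

/-- If `A` is a domain that contains a polynomial ring over `k` and becomes equal to it after
inverting one polynomial, then the spectrum of `A` is birational over `k` to affine space. -/
theorem birationalOver_affineSpace {k A ι : Type} [Field k] [CommRing A] [IsDomain A]
    [Algebra k A] (φ : MvPolynomial ι k →ₐ[k] A) (hφ : Function.Injective φ)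
    {c : MvPolynomial ι k} (hc : c ≠ 0) (h : ∀ a, ∃ (n : ℕ) (r : MvPolynomial ι k),
      φ c ^ n * a = φ r) :
    Scheme.BirationalOver (Spec.map (CommRingCat.ofHom (algebraMap k A)))
      (𝔸(ι; Spec (CommRingCat.of k)) ↘ Spec (CommRingCat.of k)) := by
  let B := Localization.Away (φ c)
  have hc' : φ c ≠ 0 := by rwa [Ne, map_eq_zero_iff φ hφ]
  have hAB : Function.Injective (algebraMap A B) :=
    IsLocalization.injective B (powers_le_nonZeroDivisors_of_noZeroDivisors hc')
  let : Algebra (MvPolynomial ι k) B := ((algebraMap A B).comp φ.toRingHom).toAlgebra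
  have hPB' (r) : algebraMap (MvPolynomial ι k) B r = algebraMap A B (φ r) := rfl
  -- The localization of `A` at `φ c` is also that of the polynomial ring at `c`, so both spectra
  -- contain the dense open subscheme `Spec B`.
  have hloc : IsLocalization.Away c B := by
    refine IsLocalization.Away.mk c (IsLocalization.Away.algebraMap_isUnit (φ c)) (fun s ↦ ?_)
      fun a b hab ↦ ⟨0, by rw [hφ (hAB hab)]⟩
    obtain ⟨n, a, ha⟩ := IsLocalization.Away.surj (φ c) s
    obtain ⟨m, r, hr⟩ := h a
    refine ⟨n + m, r, ?_⟩
    rw [hPB', hPB', ← hr, map_mul, ← ha, map_pow]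
    ring
  have h1 := IsOpenImmersion.of_isLocalization (S := B) (φ c)
  have h2 := IsOpenImmersion.of_isLocalization (S := B) c
  have h3 := isDominant_specMap (algebraMap A B) hAB
  have h4 := isDominant_specMap (algebraMap (MvPolynomial ι k) B) (hAB.comp hφ)
  have b1 := Scheme.Hom.birationalOver (Spec.map (CommRingCat.ofHom (algebraMap A B)))
    (Spec.map (CommRingCat.ofHom (algebraMap k A))) _ rfl
  have b2 := Scheme.Hom.birationalOver
    (Spec.map (CommRingCat.ofHom (algebraMap (MvPolynomial ι k) B)) ≫
      (AffineSpace.SpecIso ι (CommRingCat.of k)).inv)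
    (𝔸(ι; Spec (CommRingCat.of k)) ↘ Spec (CommRingCat.of k))
    (Spec.map (CommRingCat.ofHom (algebraMap A B)) ≫
      Spec.map (CommRingCat.ofHom (algebraMap k A))) (by
        rw [Category.assoc, AffineSpace.SpecIso_inv_over, ← Spec.map_comp, ← Spec.map_comp]
        congr 1
        ext x
        simp [hPB'])
  exact b1.symm.trans b2

end Birational

/-! ### The parametrization by the affine plane -/

section Param

variable {R : Type*} [CommRing R]

/-- The numerator of the first parameter. -/
def numU (s p : R) : R := 25 * p + s ^ 3 - 20 * s ^ 2 + 25 * s + 250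

/-- The numerator of the second parameter. -/
def numV (s p : R) : R := 5 * s * p - 2 * s ^ 3 + 10 * s ^ 2 - 125

/-- The denominator of `cycS` in terms of the parameters. -/
def denS (u v : R) : R :=
  12 * u ^ 3 + 28 * u ^ 2 * v + 19 * u * v ^ 2 + 4 * v ^ 3 + 125 * u

/-- The numerator of `cycS` in terms of the parameters. -/
def numS (u v : R) : R :=
  -20 * u ^ 3 + 20 * u ^ 2 * v + 160 * u * v ^ 2 + 135 * v ^ 3 + 625 * v

/-- The numerator of `s ^ 2 - 5 * s - 25` in terms of the parameters, where `s` is `cycS`. -/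
def numD (u v : R) : R := numS u v ^ 2 - 5 * numS u v * denS u v - 25 * denS u v ^ 2

/-- The numerator of `s * u - 5 * v` in terms of the parameters, where `s` is `cycS`. -/
def numH (u v : R) : R := u * numS u v - 5 * v * denS u v

/-- The polynomial that is inverted in the parametrization. -/
def denom (u v : R) : R := denS u v * (numS u v + 3 * denS u v) * numD u v * numH u v

/-- Homogenizing `denS` and `numS` by `y` leaves only even powers of `y`. Replacing `y ^ 2` by the
cubic then gives an identity of polynomials in `s`, `p`, and dividing by `y ^ 3` gives the claim. -/
theorem denS_mul {s p y y' : R} (hy : y * y' = 1)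
    (h : y ^ 2 = -4 * p ^ 3 + (s ^ 2 - 48 * s - 140) * p ^ 2 +
      (28 * s ^ 3 + 48 * s ^ 2 - 370 * s - 800) * p +
      (-4 * s ^ 5 - 4 * s ^ 4 + 104 * s ^ 3 + 160 * s ^ 2 - 700 * s - 1375)) :
    denS (numU s p * y') (numV s p * y') * s = numS (numU s p * y') (numV s p * y') := by
  have key : (12 * numU s p ^ 3 + 28 * numU s p ^ 2 * numV s p + 19 * numU s p * numV s p ^ 2 +
      4 * numV s p ^ 3 + 125 * numU s p * y ^ 2) * s =
      -20 * numU s p ^ 3 + 20 * numU s p ^ 2 * numV s p + 160 * numU s p * numV s p ^ 2 +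
      135 * numV s p ^ 3 + 625 * numV s p * y ^ 2 := by
    rw [h]
    simp only [numU, numV]
    ring
  simp only [denS, numS]
  linear_combination y' ^ 3 * key -
    (125 * numU s p * s - 625 * numV s p) * y' * (1 + y * y') * hy

theorem map_denS {R' : Type*} [CommRing R'] (φ : R →+* R') (u v : R) :
    φ (denS u v) = denS (φ u) (φ v) := by
  simp [denS, map_ofNat φ]

theorem map_numS {R' : Type*} [CommRing R'] (φ : R →+* R') (u v : R) :
    φ (numS u v) = numS (φ u) (φ v) := by
  simp [numS, map_ofNat φ]

theorem map_numD {R' : Type*} [CommRing R'] (φ : R →+* R') (u v : R) :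
    φ (numD u v) = numD (φ u) (φ v) := by
  simp [numD, map_ofNat φ, map_denS, map_numS]

theorem map_numH {R' : Type*} [CommRing R'] (φ : R →+* R') (u v : R) :
    φ (numH u v) = numH (φ u) (φ v) := by
  simp [numH, map_ofNat φ, map_denS, map_numS]

theorem map_denom {R' : Type*} [CommRing R'] (φ : R →+* R') (u v : R) :
    φ (denom u v) = denom (φ u) (φ v) := by
  simp [denom, map_ofNat φ, map_denS, map_numS, map_numD, map_numH]

theorem map_cycS {R' : Type*} [CommRing R'] (φ : R →+* R') (W : Fin 5 → R) :
    φ (cycS W) = cycS (φ ∘ W) := by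
  simp [cycS]

theorem map_cycP {R' : Type*} [CommRing R'] (φ : R →+* R') (W : Fin 5 → R) :
    φ (cycP W) = cycP (φ ∘ W) := by
  simp [cycP]

theorem map_cycQ {R' : Type*} [CommRing R'] (φ : R →+* R') (W : Fin 5 → R) :
    φ (cycQ W) = cycQ (φ ∘ W) := by
  simp [cycQ]

theorem map_cycY {R' : Type*} [CommRing R'] (φ : R →+* R') (W : Fin 5 → R) :
    φ (cycY W) = cycY (φ ∘ W) := by
  simp [cycY]

/-- Inverting `sliceB` thus amounts to inverting rotation-invariant elements. The monomial completes
`W 3 ^ 6` to the sixth power of the product of all members, which is `cycS W + 3`. -/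
theorem IsLyness.sliceB_mul {F : Type*} [Field F] {W : Fin 5 → F} (h : IsLyness W)
    (h3 : W 3 ≠ 0) : sliceB (W 0) (W 1) * (W 0 * W 1 * (W 0 * W 1 * W 2 * W 4) ^ 6) =
      (cycS W + 3) ^ 8 * cycY W := by
  have e : sliceB (W 0) (W 1) * (W 0 * W 1) = W 3 ^ 6 * (∏ i, W i) ^ 2 * cycY W := by
    obtain ⟨e3, e2, e4⟩ := h.eq_of_ne_zero h3
    rw [e3] at h3
    simp only [cycY, sliceB, Fin.prod_univ_five, Fin.reduceAdd, zero_add]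
    rw [e2, e3, e4]
    generalize W 0 = z at *
    generalize W 1 = w at *
    field_simp
    ring
  rw [← h.prod_eq h3]
  have e' : ∏ i, W i = W 3 * (W 0 * W 1 * W 2 * W 4) := by rw [Fin.prod_univ_five]; ring
  rw [← mul_assoc, e, e']
  ring

end Param

/-! ### The coordinate ring of the quotient -/

section Ring

open MvPolynomial

/-- Evaluation of a regular function at a point. -/
def ev (x : MTilde) : coordRingM →ₐ[ℚ] K := (Pi.evalAlgHom ℚ (fun _ ↦ K) x).comp coordRingM.val

theorem ext_ev {a b : coordRingM} (h : ∀ x, ev x a = ev x b) : a = b :=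
  Subtype.ext (funext h)

/-- The cross-ratios as regular functions. -/
def lynC (i : Fin 5) : coordRingM := ⟨fun x ↦ lyn x i, lyn_mem i⟩

theorem ev_lynC (x : MTilde) (i : Fin 5) : ev x (lynC i) = lyn x i := rfl

theorem isLyness_lynC : IsLyness lynC := fun i ↦ ext_ev fun x ↦ by
  simpa [ev_lynC] using isLyness_lyn x i

theorem sigmaStar_lynC (i : Fin 5) : sigmaStar (lynC i) = lynC (i + 1) :=
  ext_ev fun x ↦ lyn_shift x i

theorem ev_cycS (x : MTilde) : ev x (cycS lynC) = cycS (lyn x) := map_cycS (ev x).toRingHom lynC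

theorem ev_cycP (x : MTilde) : ev x (cycP lynC) = cycP (lyn x) := map_cycP (ev x).toRingHom lynC

theorem ev_cycQ (x : MTilde) : ev x (cycQ lynC) = cycQ (lyn x) := map_cycQ (ev x).toRingHom lynC

theorem ev_cycY (x : MTilde) : ev x (cycY lynC) = cycY (lyn x) := map_cycY (ev x).toRingHom lynC

theorem cycY_lyn_ne_zero (x : MTilde) : cycY (lyn x) ≠ 0 := by
  obtain ⟨hB, -⟩ := exists_sameOrbit_slice x
  have h := (isLyness_lyn x).sliceB_mul (lyn_ne_zero x 3)
  have h0 := lyn_ne_zero x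
  intro h'
  rw [h', mul_zero] at h
  simp [h0, hB] at h

theorem cycS_lyn_add_three_ne_zero (x : MTilde) : cycS (lyn x) + 3 ≠ 0 := by
  rw [← (isLyness_lyn x).prod_eq (lyn_ne_zero x 3)]
  exact Finset.prod_ne_zero_iff.2 fun i _ ↦ lyn_ne_zero x i

/-- The inverse of `cycY lynC`. -/
def invY : coordRingM :=
  ⟨_, inv_mem_coordRingM (cycY lynC).2 fun x ↦ (ev_cycY x).trans_ne (cycY_lyn_ne_zero x)⟩

/-- The inverse of `cycS lynC + 3`. -/
def invT : coordRingM :=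
  ⟨_, inv_mem_coordRingM (cycS lynC + 3).2 fun x ↦ by
    have h : (cycS lynC + 3 : coordRingM).1 x = ev x (cycS lynC + 3) := rfl
    rw [h, map_add, ev_cycS, map_ofNat]
    exact cycS_lyn_add_three_ne_zero x⟩

theorem cycY_mul_invY : cycY lynC * invY = 1 := ext_ev fun x ↦ by
  have h : ev x invY = (ev x (cycY lynC))⁻¹ := rfl
  rw [map_mul, h, map_one, mul_inv_cancel₀]
  exact (ev_cycY x).trans_ne (cycY_lyn_ne_zero x)

theorem cycS_add_three_mul_invT : (cycS lynC + 3) * invT = 1 := ext_ev fun x ↦ by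
  have h : ev x invT = (ev x (cycS lynC + 3))⁻¹ := rfl
  rw [map_mul, h, map_one, mul_inv_cancel₀]
  rw [map_add, ev_cycS, map_ofNat]
  exact cycS_lyn_add_three_ne_zero x

theorem cycS_cycY_mul_inv :
    (cycS lynC + 3) ^ 8 * cycY lynC * (invT ^ 8 * invY) = 1 := by
  rw [mul_mul_mul_comm, ← mul_pow, cycS_add_three_mul_invT, cycY_mul_invY, one_pow, one_mul]

theorem cycY_lynC_eq : cycY lynC = 2 * cycQ lynC + 2 * cycS lynC ^ 2 - 4 * cycP lynC -
    cycS lynC * cycP lynC - 15 := ext_ev fun x ↦ by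
  simpa [ev_cycS, ev_cycP, ev_cycQ, ev_cycY, map_ofNat] using
    (isLyness_lyn x).cycY_eq (lyn_ne_zero x 3)

theorem cycY_lynC_sq : cycY lynC ^ 2 = -4 * cycP lynC ^ 3 +
    (cycS lynC ^ 2 - 48 * cycS lynC - 140) * cycP lynC ^ 2 +
    (28 * cycS lynC ^ 3 + 48 * cycS lynC ^ 2 - 370 * cycS lynC - 800) * cycP lynC +
    (-4 * cycS lynC ^ 5 - 4 * cycS lynC ^ 4 + 104 * cycS lynC ^ 3 + 160 * cycS lynC ^ 2 -
      700 * cycS lynC - 1375) := ext_ev fun x ↦ by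
  simpa [ev_cycS, ev_cycP, ev_cycY, map_ofNat] using
    (isLyness_lyn x).cycY_sq (lyn_ne_zero x 3)

theorem sliceB_lynC_mul : sliceB (lynC 0) (lynC 1) *
    (lynC 0 * lynC 1 * (lynC 0 * lynC 1 * lynC 2 * lynC 4) ^ 6) =
      (cycS lynC + 3) ^ 8 * cycY lynC := ext_ev fun x ↦ by
  have h := (isLyness_lyn x).sliceB_mul (lyn_ne_zero x 3)
  have hB : ev x (sliceB (lynC 0) (lynC 1)) = sliceB (lyn x 0) (lyn x 1) :=
    map_sliceB (ev x).toRingHom _ _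
  simpa [ev_cycS, ev_cycY, ev_lynC, map_ofNat, hB] using h

theorem ev_aeval_lynC (x : MTilde) (P : MvPolynomial (Fin 2) ℚ) :
    ev x (aeval ![lynC 0, lynC 1] P) = aeval ![lyn x 0, lyn x 1] P := by
  rw [← AlgHom.comp_apply, comp_aeval]
  congr 2
  funext i
  fin_cases i <;> rfl

theorem exists_sliceB_pow_mul_eq_aeval (h : coordRingM) :
    ∃ (n : ℕ) (P : MvPolynomial (Fin 2) ℚ),
      sliceB (lynC 0) (lynC 1) ^ n * h = aeval ![lynC 0, lynC 1] P := by
  obtain ⟨n, P, hP⟩ := exists_sliceB_pow_mul_eq h.2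
  refine ⟨n, P, ext_ev fun x ↦ ?_⟩
  rw [ev_aeval_lynC, ← hP, map_mul, map_pow]
  congr 2

theorem algebraicIndependent_lynC : AlgebraicIndependent ℚ ![lynC 0, lynC 1] := by
  refine (injective_iff_map_eq_zero _).2 fun P hP ↦ eq_zero_of_aeval_lyn fun x ↦ ?_
  rw [← ev_aeval_lynC, hP, map_zero]

theorem isUnit_sliceB_lynC : IsUnit (sliceB (lynC 0) (lynC 1)) := by
  refine .of_mul_eq_one (lynC 0 * lynC 1 * (lynC 0 * lynC 1 * lynC 2 * lynC 4) ^ 6 *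
    (invT ^ 8 * invY)) ?_
  rw [← mul_assoc, sliceB_lynC_mul]
  exact cycS_cycY_mul_inv

instance : IsDomain coordRingM := by
  have : Nontrivial coordRingM := by
    refine ⟨0, 1, fun h ↦ ?_⟩
    have := algebraicIndependent_lynC.ne_zero 0
    exact this ((mul_one (lynC 0)).symm.trans (by rw [← h, mul_zero]))
  have : NoZeroDivisors coordRingM := by
    refine ⟨fun {a b} hab ↦ ?_⟩
    obtain ⟨m, P, hP⟩ := exists_sliceB_pow_mul_eq_aeval a
    obtain ⟨n, Q, hQ⟩ := exists_sliceB_pow_mul_eq_aeval b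
    have h0 : aeval ![lynC 0, lynC 1] (P * Q) = 0 := by
      rw [map_mul, ← hP, ← hQ]
      -- Clearing denominators moves the zero product into the polynomial ring in two variables, a
      -- domain.
      linear_combination sliceB (lynC 0) (lynC 1) ^ (m + n) * hab
    have := (injective_iff_map_eq_zero _).1 algebraicIndependent_lynC _ h0
    rcases mul_eq_zero.1 this with rfl | rfl
    · rw [map_zero, (isUnit_sliceB_lynC.pow m).mul_right_eq_zero] at hP
      exact Or.inl hP
    · rw [map_zero, (isUnit_sliceB_lynC.pow n).mul_right_eq_zero] at hQ
      exact Or.inr hQ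
  exact NoZeroDivisors.to_isDomain _

end Ring

/-! ### Invariant functions and the two parameters -/

section Quotient

open MvPolynomial

theorem succ_two_comm (i : Fin 5) : i + 2 + 1 = i + 1 + 2 := add_right_comm i 2 1

theorem sigmaStar_cycS : sigmaStar (cycS lynC) = cycS lynC := by
  simp only [cycS, map_sum, sigmaStar_lynC]
  exact Equiv.sum_comp (Equiv.addRight 1) lynC

theorem sigmaStar_cycP : sigmaStar (cycP lynC) = cycP lynC := by
  simp only [cycP, map_sum, map_mul, sigmaStar_lynC, succ_two_comm]
  exact Equiv.sum_comp (Equiv.addRight 1) fun i ↦ lynC i * lynC (i + 2)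

theorem sigmaStar_cycQ : sigmaStar (cycQ lynC) = cycQ lynC := by
  simp only [cycQ, map_sum, map_mul, map_pow, sigmaStar_lynC, succ_two_comm]
  exact Equiv.sum_comp (Equiv.addRight 1) fun i ↦ lynC i ^ 2 * lynC (i + 2)

theorem sigmaStar_cycY : sigmaStar (cycY lynC) = cycY lynC := by
  simp only [cycY, map_prod, map_sub, sigmaStar_lynC, succ_two_comm]
  exact Equiv.prod_comp (Equiv.addRight 1) fun i ↦ lynC i - lynC (i + 2)

theorem sigmaStar_invY : sigmaStar invY = invY := by
  have h := congrArg sigmaStar cycY_mul_invY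
  rw [map_mul, sigmaStar_cycY, map_one] at h
  linear_combination invY * h - sigmaStar invY * cycY_mul_invY

/-- The first parameter. -/
def parU : coordRingM := numU (cycS lynC) (cycP lynC) * invY

/-- The second parameter. -/
def parV : coordRingM := numV (cycS lynC) (cycP lynC) * invY

theorem parU_mem : parU ∈ coordRingQuotient := by
  change sigmaStar parU = parU
  simp [parU, numU, sigmaStar_cycS, sigmaStar_cycP, sigmaStar_invY, map_ofNat sigmaStar]

theorem parV_mem : parV ∈ coordRingQuotient := by
  change sigmaStar parV = parV
  simp [parV, numV, sigmaStar_cycS, sigmaStar_cycP, sigmaStar_invY, map_ofNat sigmaStar]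

/-- The homomorphism from the polynomial ring given by the two parameters. -/
def parHom : MvPolynomial (Fin 2) ℚ →ₐ[ℚ] coordRingM := aeval ![parU, parV]

/-- The polynomial `denom` in the variables. -/
def denomPoly : MvPolynomial (Fin 2) ℚ := denom (X 0) (X 1)

/-- The regular functions that become polynomials in the parameters after multiplication by a power
of `denomPoly`. -/
def parAlgebra : Subalgebra ℚ coordRingM where
  carrier := {h | ∃ (n : ℕ) (r : MvPolynomial (Fin 2) ℚ), parHom denomPoly ^ n * h = parHom r}
  mul_mem' := by
    rintro a b ⟨m, r, hr⟩ ⟨n, t, ht⟩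
    refine ⟨m + n, r * t, ?_⟩
    rw [map_mul, ← hr, ← ht]
    ring
  add_mem' := by
    rintro a b ⟨m, r, hr⟩ ⟨n, t, ht⟩
    refine ⟨m + n, denomPoly ^ n * r + denomPoly ^ m * t, ?_⟩
    rw [map_add, map_mul, map_mul, map_pow, map_pow, ← hr, ← ht]
    ring
  algebraMap_mem' c := ⟨0, C c, by rw [pow_zero, one_mul, algHom_C]⟩

theorem parHom_mem (r : MvPolynomial (Fin 2) ℚ) : parHom r ∈ parAlgebra :=
  ⟨0, r, by rw [pow_zero, one_mul]⟩

theorem mem_parAlgebra_of_mul {d : MvPolynomial (Fin 2) ℚ} (hd : d ∣ denomPoly) {h : coordRingM}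
    (hm : parHom d * h ∈ parAlgebra) : h ∈ parAlgebra := by
  obtain ⟨e, he⟩ := hd
  obtain ⟨n, r, hr⟩ := mul_mem (parHom_mem e) hm
  refine ⟨n + 1, r, ?_⟩
  have he' : parHom denomPoly = parHom d * parHom e := by rw [← map_mul, ← he]
  rw [← hr, pow_succ]
  linear_combination parHom denomPoly ^ n * h * he'

theorem parHom_denS : parHom (denS (X 0) (X 1)) = denS parU parV := by
  have := map_denS parHom.toRingHom (X 0) (X 1)
  simpa [parHom] using this

theorem parHom_numS : parHom (numS (X 0) (X 1)) = numS parU parV := by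
  have := map_numS parHom.toRingHom (X 0) (X 1)
  simpa [parHom] using this

theorem parHom_numD : parHom (numD (X 0) (X 1)) = numD parU parV := by
  have := map_numD parHom.toRingHom (X 0) (X 1)
  simpa [parHom] using this

theorem parHom_numH : parHom (numH (X 0) (X 1)) = numH parU parV := by
  have := map_numH parHom.toRingHom (X 0) (X 1)
  simpa [parHom] using this

theorem parHom_denomPoly : parHom denomPoly = denom parU parV := by
  have := map_denom parHom.toRingHom (X 0) (X 1)
  simpa [parHom, denomPoly] using this

theorem parU_mem_parAlgebra : parU ∈ parAlgebra := by
  simpa [parHom] using parHom_mem (X 0)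

theorem parV_mem_parAlgebra : parV ∈ parAlgebra := by
  simpa [parHom] using parHom_mem (X 1)

theorem denS_par_mul : denS parU parV * cycS lynC = numS parU parV :=
  denS_mul cycY_mul_invY cycY_lynC_sq

theorem numD_par : numD parU parV =
    denS parU parV ^ 2 * (cycS lynC ^ 2 - 5 * cycS lynC - 25) := by
  rw [numD, ← denS_par_mul]
  ring

/-- The `p`-terms cancel in `s * numU - 5 * numV`, and what remains is a perfect square in `s`. Its
root vanishes at the constant cycles: there `W ^ 2 = W + 1` and `s = 5 * W`. This relation recovers
`y` from `s` and the parameters. -/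
theorem sq_mul_invY : (cycS lynC ^ 2 - 5 * cycS lynC - 25) ^ 2 * invY =
    cycS lynC * parU - 5 * parV := by
  simp only [parU, parV, numU, numV]
  ring

theorem numH_par : numH parU parV =
    denS parU parV * ((cycS lynC ^ 2 - 5 * cycS lynC - 25) ^ 2 * invY) := by
  rw [numH, ← denS_par_mul, sq_mul_invY]
  ring

theorem denS_dvd : denS (X 0) (X 1) ∣ denomPoly :=
  ⟨_, by rw [denomPoly, denom, mul_assoc, mul_assoc]⟩

theorem numT_dvd : numS (X 0) (X 1) + 3 * denS (X 0) (X 1) ∣ denomPoly :=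
  ((Dvd.intro_left _ rfl).mul_right _).mul_right _

theorem numD_dvd : numD (X 0) (X 1) ∣ denomPoly :=
  (Dvd.intro_left _ rfl).mul_right _

theorem numH_dvd : numH (X 0) (X 1) ∣ denomPoly := Dvd.intro_left _ rfl

theorem cycS_mem_parAlgebra : cycS lynC ∈ parAlgebra := by
  refine mem_parAlgebra_of_mul denS_dvd ?_
  rw [parHom_denS, denS_par_mul, ← parHom_numS]
  exact parHom_mem _

theorem invT_mem_parAlgebra : invT ∈ parAlgebra := by
  refine mem_parAlgebra_of_mul numT_dvd ?_
  have e : parHom (numS (X 0) (X 1) + 3 * denS (X 0) (X 1)) * invT =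
      parHom (denS (X 0) (X 1)) := by
    rw [map_add, map_mul, map_ofNat, parHom_numS, parHom_denS, ← denS_par_mul]
    linear_combination denS parU parV * cycS_add_three_mul_invT
  rw [e]
  exact parHom_mem _

theorem invY_mem_parAlgebra : invY ∈ parAlgebra := by
  refine mem_parAlgebra_of_mul numD_dvd (mem_parAlgebra_of_mul numD_dvd ?_)
  have e : parHom (numD (X 0) (X 1)) * (parHom (numD (X 0) (X 1)) * invY) =
      parHom (denS (X 0) (X 1)) ^ 4 * (cycS lynC * parU - 5 • parV) := by
    rw [parHom_numD, parHom_denS, numD_par, nsmul_eq_mul, Nat.cast_ofNat, ← sq_mul_invY]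
    ring
  rw [e]
  exact mul_mem (pow_mem (parHom_mem _) 4) (sub_mem
    (mul_mem cycS_mem_parAlgebra parU_mem_parAlgebra) (nsmul_mem parV_mem_parAlgebra 5))

theorem cycY_mem_parAlgebra : cycY lynC ∈ parAlgebra := by
  refine mem_parAlgebra_of_mul numH_dvd ?_
  have e : parHom (numH (X 0) (X 1)) * cycY lynC =
      parHom (denS (X 0) (X 1)) * (cycS lynC ^ 2 - 5 • cycS lynC - 25) ^ 2 := by
    rw [parHom_numH, parHom_denS, numH_par, nsmul_eq_mul, Nat.cast_ofNat]
    linear_combination denS parU parV * (cycS lynC ^ 2 - 5 * cycS lynC - 25) ^ 2 * cycY_mul_invY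
  rw [e]
  exact mul_mem (parHom_mem _) (pow_mem (sub_mem (sub_mem (pow_mem cycS_mem_parAlgebra 2)
    (nsmul_mem cycS_mem_parAlgebra 5)) (ofNat_mem parAlgebra 25)) 2)

theorem mem_of_natCast_mul_mem {S : Subalgebra ℚ coordRingM} {n : ℕ} (hn : n ≠ 0)
    {h : coordRingM} (hm : (n : coordRingM) * h ∈ S) : h ∈ S := by
  have := S.smul_mem hm (n : ℚ)⁻¹
  rwa [← nsmul_eq_mul, ← Nat.cast_smul_eq_nsmul ℚ, smul_smul,
    inv_mul_cancel₀ (Nat.cast_ne_zero.2 hn), one_smul] at this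

theorem cycP_mem_parAlgebra : cycP lynC ∈ parAlgebra := by
  refine mem_of_natCast_mul_mem (n := 25) (by norm_num) ?_
  have e : ((25 : ℕ) : coordRingM) * cycP lynC = parU * cycY lynC - cycS lynC ^ 3 +
      20 * cycS lynC ^ 2 - 25 * cycS lynC - 250 := by
    simp only [parU, numU]
    push_cast
    linear_combination -(25 * cycP lynC + cycS lynC ^ 3 - 20 * cycS lynC ^ 2 + 25 * cycS lynC +
      250) * cycY_mul_invY
  rw [e]
  have hs := cycS_mem_parAlgebra
  exact sub_mem (sub_mem (add_mem (sub_mem (mul_mem parU_mem_parAlgebra cycY_mem_parAlgebra)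
    (pow_mem hs 3)) (mul_mem (ofNat_mem _ 20) (pow_mem hs 2))) (mul_mem (ofNat_mem _ 25) hs))
    (ofNat_mem _ 250)

theorem cycQ_mem_parAlgebra : cycQ lynC ∈ parAlgebra := by
  refine mem_of_natCast_mul_mem (n := 2) (by norm_num) ?_
  have e : ((2 : ℕ) : coordRingM) * cycQ lynC = cycY lynC - 2 * cycS lynC ^ 2 + 4 * cycP lynC +
      cycS lynC * cycP lynC + 15 := by
    rw [cycY_lynC_eq]
    push_cast
    ring
  rw [e]
  have hs := cycS_mem_parAlgebra
  have hp := cycP_mem_parAlgebra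
  exact add_mem (add_mem (add_mem (sub_mem cycY_mem_parAlgebra
    (mul_mem (ofNat_mem _ 2) (pow_mem hs 2))) (mul_mem (ofNat_mem _ 4) hp)) (mul_mem hs hp))
    (ofNat_mem _ 15)

/-- The algebra generated by the three basic invariants. -/
def invAlgebra : Subalgebra ℚ coordRingM :=
  Algebra.adjoin ℚ {cycS lynC, cycP lynC, cycQ lynC}

theorem cycS_mem_invAlgebra : cycS lynC ∈ invAlgebra := Algebra.subset_adjoin (by simp)

theorem cycP_mem_invAlgebra : cycP lynC ∈ invAlgebra := Algebra.subset_adjoin (by simp)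

theorem cycQ_mem_invAlgebra : cycQ lynC ∈ invAlgebra := Algebra.subset_adjoin (by simp)

theorem invAlgebra_le_parAlgebra : invAlgebra ≤ parAlgebra := by
  refine Algebra.adjoin_le ?_
  rintro _ (rfl | rfl | rfl)
  exacts [cycS_mem_parAlgebra, cycP_mem_parAlgebra, cycQ_mem_parAlgebra]

theorem invAlgebra_le_coordRingQuotient : invAlgebra ≤ coordRingQuotient := by
  refine Algebra.adjoin_le ?_
  rintro _ (rfl | rfl | rfl)
  exacts [sigmaStar_cycS, sigmaStar_cycP, sigmaStar_cycQ]

theorem aeval_lynC_mem (P : MvPolynomial (Fin 2) ℚ) :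
    aeval ![lynC 0, lynC 1] P ∈ Algebra.adjoin ℚ (Set.range lynC) := by
  have h : aeval ![lynC 0, lynC 1] P ∈ Algebra.adjoin ℚ (Set.range ![lynC 0, lynC 1]) := by
    rw [Algebra.adjoin_range_eq_range_aeval]
    exact ⟨P, rfl⟩
  refine Algebra.adjoin_mono ?_ h
  rintro _ ⟨i, rfl⟩
  fin_cases i
  exacts [⟨0, rfl⟩, ⟨1, rfl⟩]

theorem coordRingQuotient_le_parAlgebra : coordRingQuotient ≤ parAlgebra := by
  intro h hh
  change sigmaStar h = h at hh
  obtain ⟨n, P, hP⟩ := exists_sliceB_pow_mul_eq_aeval h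
  -- The denominator `sliceB ^ n` is replaced by an invariant multiple, so that the numerator is an
  -- invariant polynomial in the cross-ratios.
  have hmem : ((cycS lynC + 3) ^ 8 * cycY lynC) ^ n * h ∈
      Algebra.adjoin ℚ (Set.range lynC) := by
    rw [← sliceB_lynC_mul, mul_pow, mul_right_comm, hP]
    have hl (i : Fin 5) : lynC i ∈ Algebra.adjoin ℚ (Set.range lynC) :=
      Algebra.subset_adjoin ⟨i, rfl⟩
    exact mul_mem (aeval_lynC_mem P) (pow_mem (mul_mem (mul_mem (hl 0) (hl 1))
      (pow_mem (mul_mem (mul_mem (mul_mem (hl 0) (hl 1)) (hl 2)) (hl 4)) 6)) n)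
  have hinv := isLyness_lynC.mem_of_invariant cycS_mem_invAlgebra cycP_mem_invAlgebra
    cycQ_mem_invAlgebra sigmaStar_lynC invAlgebra_le_coordRingQuotient hmem (by
      simp only [map_mul, map_pow, map_add, map_ofNat, sigmaStar_cycS, sigmaStar_cycY, hh])
  have e : h = (invT ^ 8 * invY) ^ n * (((cycS lynC + 3) ^ 8 * cycY lynC) ^ n * h) := by
    rw [← mul_assoc, ← mul_pow, mul_comm (invT ^ 8 * invY), cycS_cycY_mul_inv, one_pow, one_mul]
  rw [e]
  exact mul_mem (pow_mem (mul_mem (pow_mem invT_mem_parAlgebra 8) invY_mem_parAlgebra) n)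
    (invAlgebra_le_parAlgebra hinv)

theorem denom_par_ne_zero : denom parU parV ≠ 0 := by
  intro h0
  -- A sample point suffices: at `z = 2`, `w = 3` all invariants are explicit rational numbers.
  have hB : sliceB (2 : K) 3 ≠ 0 := by norm_num [sliceB]
  have hW := isLyness_lyn (slice 2 3 hB)
  obtain ⟨e3, e2, e4⟩ := hW.eq_of_ne_zero (lyn_ne_zero _ 3)
  have e0 := lyn_slice_zero hB
  have e1 := lyn_slice_one hB
  rw [e0, e1] at e2 e3 e4
  have hs : cycS (lyn (slice 2 3 hB)) = 57 / 5 := by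
    rw [cycS, Fin.sum_univ_five, e0, e1, e2, e3, e4]; norm_num
  have hp : cycP (lyn (slice 2 3 hB)) = 727 / 25 := by
    simp only [cycP, Fin.sum_univ_five, Fin.reduceAdd, zero_add]
    rw [e0, e1, e2, e3, e4]; norm_num
  have hy : cycY (lyn (slice 2 3 hB)) = -462 / 125 := by
    simp only [cycY, Fin.prod_univ_five, Fin.reduceAdd, zero_add]
    rw [e0, e1, e2, e3, e4]; norm_num
  have hi : ev (slice 2 3 hB) invY = -125 / 462 := by
    have h : ev (slice 2 3 hB) invY = (ev (slice 2 3 hB) (cycY lynC))⁻¹ := rfl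
    rw [h, ev_cycY, hy]; norm_num
  have hU : ev (slice 2 3 hB) parU = -18043 / 462 := by
    simp only [parU, numU, map_mul, map_add, map_sub, map_pow, map_ofNat, ev_cycS, ev_cycP, hi, hs,
      hp]
    norm_num
  have hV : ev (slice 2 3 hB) parV = 1169 / 33 := by
    simp only [parV, numV, map_mul, map_add, map_sub, map_pow, map_ofNat, ev_cycS, ev_cycP, hi, hs,
      hp]
    norm_num
  have h1 := map_denom (ev (slice 2 3 hB)).toRingHom parU parV
  simp only [AlgHom.toRingHom_eq_coe, RingHom.coe_coe, hU, hV, h0, map_zero] at h1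
  norm_num [denom, denS, numS, numD, numH] at h1

theorem isAlgebraic_of_mem_parAlgebra {h : coordRingM} (hh : h ∈ parAlgebra) :
    IsAlgebraic (Algebra.adjoin ℚ (Set.range ![parU, parV])) h := by
  obtain ⟨n, r, hr⟩ := hh
  have hmem (r : MvPolynomial (Fin 2) ℚ) :
      IsAlgebraic (Algebra.adjoin ℚ (Set.range ![parU, parV])) (parHom r) := by
    have h' : parHom r ∈ Algebra.adjoin ℚ (Set.range ![parU, parV]) := by
      rw [Algebra.adjoin_range_eq_range_aeval]
      exact ⟨r, rfl⟩
    exact isAlgebraic_algebraMap (⟨_, h'⟩ : Algebra.adjoin ℚ (Set.range ![parU, parV]))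
  refine IsAlgebraic.of_mul (y := parHom denomPoly ^ n) ?_ ?_ (hr ▸ hmem r)
  · refine mem_nonZeroDivisors_of_ne_zero (pow_ne_zero _ ?_)
    rw [parHom_denomPoly]
    exact denom_par_ne_zero
  · rw [← map_pow]
    exact hmem _

/-- The cross-ratios are integral over the algebra of invariants, whose generators are fractions in
the two parameters. -/
theorem isAlgebraic_lynC (i : Fin 5) :
    IsAlgebraic (Algebra.adjoin ℚ (Set.range ![parU, parV])) (lynC i) := by
  refine IsAlgebraic.adjoin_of_forall_isAlgebraic
    (s := {cycS lynC, cycP lynC, cycQ lynC}) (fun x hx ↦ ?_) ?_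
  · refine isAlgebraic_of_mem_parAlgebra ?_
    obtain ⟨rfl | rfl | rfl, -⟩ := hx
    exacts [cycS_mem_parAlgebra, cycP_mem_parAlgebra, cycQ_mem_parAlgebra]
  · exact (isLyness_lynC.isIntegral (S := invAlgebra) cycS_mem_invAlgebra cycP_mem_invAlgebra
      cycQ_mem_invAlgebra i).isAlgebraic

theorem isAlgebraic_coordRingM :
    Algebra.IsAlgebraic (Algebra.adjoin ℚ (Set.range ![parU, parV])) coordRingM := by
  have hpoly {a : coordRingM} (ha : a ∈ Algebra.adjoin ℚ (Set.range lynC)) :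
      IsAlgebraic (Algebra.adjoin ℚ (Set.range ![parU, parV])) a := by
    induction ha using Algebra.adjoin_induction with
    | mem x hx =>
      obtain ⟨i, rfl⟩ := hx
      exact isAlgebraic_lynC i
    | algebraMap c => exact isAlgebraic_of_mem_parAlgebra (algebraMap_mem _ c)
    | add x y _ _ hx hy => exact hx.add hy
    | mul x y _ _ hx hy => exact hx.mul hy
  refine ⟨fun h ↦ ?_⟩
  obtain ⟨n, P, hP⟩ := exists_sliceB_pow_mul_eq_aeval h
  refine IsAlgebraic.of_mul (y := sliceB (lynC 0) (lynC 1) ^ n) ?_ (hpoly ?_)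
    (hP ▸ hpoly (aeval_lynC_mem P))
  · exact (isUnit_sliceB_lynC.pow n).mem_nonZeroDivisors
  · have e := aeval_lynC_mem (sliceB (X 0) (X 1) ^ n)
    rw [map_pow] at e
    have e' := map_sliceB (aeval ![lynC 0, lynC 1] :
      MvPolynomial (Fin 2) ℚ →ₐ[ℚ] coordRingM).toRingHom (X 0) (X 1)
    simp only [AlgHom.toRingHom_eq_coe, RingHom.coe_coe, aeval_X] at e'
    rw [e'] at e
    exact e

/-- The ring has transcendence degree at least two, because of `lynC 0` and `lynC 1`, and is
algebraic over the subalgebra generated by two elements. Those two must therefore be algebraically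
independent. -/
theorem parHom_injective : Function.Injective parHom := by
  have : FaithfulSMul ℚ coordRingM :=
    (faithfulSMul_iff_algebraMap_injective ℚ coordRingM).2 (algebraMap ℚ coordRingM).injective
  have := isAlgebraic_coordRingM
  have hle := algebraicIndependent_lynC.lift_cardinalMk_le_trdeg
  exact (Algebra.IsAlgebraic.isTranscendenceBasis_of_lift_le_trdeg_of_finite ℚ ![parU, parV] hle).1

/-- The homomorphism given by the two parameters, with values in the ring of the quotient. -/
def quotHom : MvPolynomial (Fin 2) ℚ →ₐ[ℚ] coordRingQuotient :=
  aeval ![⟨parU, parU_mem⟩, ⟨parV, parV_mem⟩]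

theorem coe_quotHom (r : MvPolynomial (Fin 2) ℚ) : (quotHom r : coordRingM) = parHom r := by
  have h : coordRingQuotient.val.comp quotHom = parHom := by
    refine MvPolynomial.algHom_ext fun i ↦ ?_
    fin_cases i <;> simp [quotHom, parHom]
  exact DFunLike.congr_fun h r

end Quotient

end PeriodFive

end

open AlgebraicGeometry in
/-- The surface `M₂(5) / ⟨σ₅⟩` is rational over `ℚ`: it is birational over `ℚ` to the affine plane. -/
theorem mainTheorem9 :
    Scheme.BirationalOver PeriodFive.MQuotient.toSpecRat
      (𝔸(Fin 2; Spec (CommRingCat.of ℚ)) ↘ Spec (CommRingCat.of ℚ)) := by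
  refine PeriodFive.birationalOver_affineSpace PeriodFive.quotHom (fun a b h ↦ ?_)
    (c := PeriodFive.denomPoly) (fun h ↦ ?_) fun a ↦ ?_
  · refine PeriodFive.parHom_injective ?_
    rw [← PeriodFive.coe_quotHom, h, PeriodFive.coe_quotHom]
  · refine PeriodFive.denom_par_ne_zero ?_
    rw [← PeriodFive.parHom_denomPoly, h, map_zero]
  · obtain ⟨n, r, hr⟩ := PeriodFive.coordRingQuotient_le_parAlgebra a.2
    refine ⟨n, r, Subtype.ext ?_⟩
    rw [PeriodFive.coe_quotHom, ← hr, ← PeriodFive.coe_quotHom]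
    rfl
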